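/- Let $k<P$ and let $$y(n,m)=\sum_{i=1}^{P}\rho_i^0\cos(\omega_i^0 n+\upsilon_i^0 m+\varphi_i^0)+w(n,m),\qquad w(n,m)=\sum_{(r,s)\in D}a(r,s)\,u(n-r,m-s),$$ where $D=\{(r,s)\in\mathbb Z^2: r=0,\ s\ge 0\}\cup\{(r,s)\in\mathbb Z^2: r>0\}$. Assume: 1. $\{u(n,m)\}_{(n,m)\in\mathbb Z^2}$ is a real i.i.d. zero-mean field with finite variance and $E|u(n,m)|^\alpha<\infty$ for some $\alpha>3$; 2. $\sum_{(r,s)\in D}|a(r,s)|<\infty$; 3. the pairs $(\omega_i^0,\upsilon_i^0)\in(0,2\pi)^2$, $1\le i\le P$, are pairwise different as frequencies of real sinusoids: $(\omega_i^0,\upsilon_i^0)\neq(\omega_j^0,\upsilon_j^0)$ for $i\ne j$, and $(\omega_i^0,\upsilon_i^0)\ne(2\pi-\omega_j^0,2\pi-\upsilon_j^0)$ for all $i,j$; 4. $\rho_1^0\ge\dots\ge\rho_k^0>\rho_{k+1}^0\ge\dots\ge\rho_P^0>0$. Let the parameter space $\Theta_k$ be a compact (bounded and closed) subset of $\mathbb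 R^{4k}$ whose elements $\theta_k=(\rho_i,\omega_i,\upsilon_i,\varphi_i)_{i=1}^k$ all satisfy $\rho_i\neq0$, $(\omega_i,\upsilon_i)\in(0,2\pi)^2$, $\varphi_i\in[0,2\pi)$ and $(\omega_i,\upsilon_i)\ne(\omega_j,\upsilon_j)$ for $i\neq j$, and suppose that $\Theta_k$ contains the vector $\theta_k^0=(\rho_i^0,\omega_i^0,\upsilon_i^0,\varphi_i^0)_{i=1}^k$ of parameters of the $k$ dominant sinusoids. Let $(N_l,M_l)$ be a sequence of sizes with $\min(N_l,M_l)\to\infty$ and $N_l/M_l\to c$ for some $c\in(0,\infty)$, and for each $l$ let $\hat\theta_k$ be a least squares estimate, i.e. almost surely a minimizer over $\Theta_k$ of $$\mathcal L_k(\theta_k)=\frac1{NM}\sum_{n=0}^{N-1}\sum_{m=0}^{M-1}\Big(y(n,m)-\sum_{i=1}^k\rho_i\cos(\omega_i n+\upsilon_i m+\varphi_i)\Big)^2,\qquad (N,M)=(N_l,M_l).$$ Say that $\theta_k$ describes the same sinusoids as $\theta_k^0$ if, for some permutation $\sigma$ of $\{1,\dots,k\}$, $\rho_{\sigma(i)}\cos(\omega_{\sigma(i)}n+\upsilon_{\sigma(i)}m+\varphi_{\sigma(i)})=\rho_i^0\cos(\omega_i^0n+\upsilon_i^0m+\varphi_i^0)$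 for all $i$ and all integers $n,m\ge0$. Then, as $l\to\infty$: (a) if $\theta_k^0$ is the only element of $\Theta_k$ that describes the same sinusoids as $\theta_k^0$, then $\hat\theta_k\to\theta_k^0$ almost surely; (b) in general, the distance of $\hat\theta_k$ to the set of those $\theta_k\in\Theta_k$ that describe the same sinusoids as $\theta_k^0$ tends to $0$ almost surely. -/

import Mathlib

open Filter Topology MeasureTheory ProbabilityTheory

noncomputable section

namespace SinusoidLSE

/-- The vector of parameters of `k` two-dimensional sinusoids (a point of `ℝ ^ (4 k)`): component
`i` is the quadruple `(ρ i, ω i, υ i, φ i)`. -/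
abbrev Params (k : ℕ) : Type := Fin k → ℝ × ℝ × ℝ × ℝ

/-- Amplitude of the `i`-th sinusoid. -/
def amp {k : ℕ} (θ : Params k) (i : Fin k) : ℝ := (θ i).1

/-- First spatial frequency of the `i`-th sinusoid. -/
def freq₁ {k : ℕ} (θ : Params k) (i : Fin k) : ℝ := (θ i).2.1

/-- Second spatial frequency of the `i`-th sinusoid. -/
def freq₂ {k : ℕ} (θ : Params k) (i : Fin k) : ℝ := (θ i).2.2.1

/-- Phase of the `i`-th sinusoid. -/
def phase {k : ℕ} (θ : Params k) (i : Fin k) : ℝ := (θ i).2.2.2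

/-- The `i`-th sinusoid `ρ i * cos (ω i * n + υ i * m + φ i)`. -/
def sinusoid {k : ℕ} (θ : Params k) (i : Fin k) (n m : ℕ) : ℝ :=
  amp θ i * Real.cos (freq₁ θ i * n + freq₂ θ i * m + phase θ i)

/-- The parameters of the first `k` of `P` sinusoids. -/
def firstParams {k P : ℕ} (h : k ≤ P) (θ : Params P) : Params k := fun i => θ (Fin.castLE h i)

/-- The two vectors describe the same `k` sinusoids, up to the order in which they are listed. -/
def SameSinusoids {k : ℕ} (θ θ' : Params k) : Prop :=
  ∃ σ : Equiv.Perm (Fin k), ∀ i, ∀ n m : ℕ, sinusoid θ (σ i) n m = sinusoid θ' i n m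

/-- The infinite order non-symmetrical half-plane support. -/
def halfPlane : Set (ℤ × ℤ) := {p | (p.1 = 0 ∧ 0 ≤ p.2) ∨ 0 < p.1}

variable {Ω : Type*} [MeasurableSpace Ω]

/-- The moving average noise field
`w (n, m) = ∑_{(r, s) ∈ D} a (r, s) * u (n - r, m - s)`, `D` the non-symmetrical half-plane. -/
def noise (a : ℤ × ℤ → ℝ) (u : ℤ × ℤ → Ω → ℝ) (n m : ℤ) (x : Ω) : ℝ :=
  ∑' p : halfPlane, a p.1 * u (n - p.1.1, m - p.1.2) x

/-- The observed field: the sum of the `P` sinusoids with parameters `θ₀` and of the noise. -/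
def observed {P : ℕ} (θ₀ : Params P) (a : ℤ × ℤ → ℝ) (u : ℤ × ℤ → Ω → ℝ) (n m : ℕ) (x : Ω) : ℝ :=
  (∑ i, sinusoid θ₀ i n m) + noise a u n m x

/-- The driving field is i.i.d., zero-mean, of finite variance, with a finite absolute moment of
some order larger than 3. -/
structure DrivingField (μ : Measure Ω) (u : ℤ × ℤ → Ω → ℝ) : Prop where
  measurable : ∀ p, Measurable (u p)
  indep : iIndepFun u μ
  ident : ∀ p q, IdentDistrib (u p) (u q) μ μ
  finite_variance : ∀ p, MemLp (u p) 2 μ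
  zero_mean : ∀ p, ∫ x, u p x ∂μ = 0
  moment : ∃ α : ℝ, 3 < α ∧ ∀ p, Integrable (fun x => |u p x| ^ α) μ

/-- The moving average coefficients are absolutely summable over the half-plane. -/
def AbsSummable (a : ℤ × ℤ → ℝ) : Prop := Summable fun p : halfPlane => |a p.1|

/-- The frequency pairs lie in `(0, 2π) × (0, 2π)` and are pairwise different as frequencies of
real sinusoids: the pairs `± (ω i, υ i)` are `2 P` different pairs modulo `2π`. -/
structure DistinctFrequencies {P : ℕ} (θ₀ : Params P) : Prop where
  freq₁_mem : ∀ i, freq₁ θ₀ i ∈ Set.Ioo 0 (2 * Real.pi)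
  freq₂_mem : ∀ i, freq₂ θ₀ i ∈ Set.Ioo 0 (2 * Real.pi)
  ne : ∀ i j, i ≠ j → freq₁ θ₀ i ≠ freq₁ θ₀ j ∨ freq₂ θ₀ i ≠ freq₂ θ₀ j
  ne_neg : ∀ i j, freq₁ θ₀ i + freq₁ θ₀ j ≠ 2 * Real.pi ∨ freq₂ θ₀ i + freq₂ θ₀ j ≠ 2 * Real.pi

/-- `ρ 1 ≥ ρ 2 ≥ … ≥ ρ k > ρ (k + 1) ≥ … ≥ ρ P > 0`. -/
structure DominantFirst {P : ℕ} (k : ℕ) (θ₀ : Params P) : Prop where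
  antitone : Antitone (amp θ₀)
  gap : ∀ i j : Fin P, (i : ℕ) < k → k ≤ (j : ℕ) → amp θ₀ j < amp θ₀ i
  pos : ∀ i, 0 < amp θ₀ i

/-- A parameter space: a bounded and closed set of vectors in
`ℝ^k × ((0, 2π) × (0, 2π))^k × [0, 2π)^k` with non-zero amplitudes and pairwise different
frequency pairs. -/
structure IsParameterSpace {k : ℕ} (Θ : Set (Params k)) : Prop where
  compact : IsCompact Θ
  amp_ne_zero : ∀ θ ∈ Θ, ∀ i, amp θ i ≠ 0
  freq₁_mem : ∀ θ ∈ Θ, ∀ i, freq₁ θ i ∈ Set.Ioo 0 (2 * Real.pi)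
  freq₂_mem : ∀ θ ∈ Θ, ∀ i, freq₂ θ i ∈ Set.Ioo 0 (2 * Real.pi)
  phase_mem : ∀ θ ∈ Θ, ∀ i, phase θ i ∈ Set.Ico 0 (2 * Real.pi)
  ne : ∀ θ ∈ Θ, ∀ i j, i ≠ j → freq₁ θ i ≠ freq₁ θ j ∨ freq₂ θ i ≠ freq₂ θ j

/-- The rectangles `{0, …, N i - 1} × {0, …, M i - 1}` tend to infinity: both sides do, and their
ratio has a limit in `(0, ∞)`. -/
structure RectanglesTendToInfinity (N M : ℕ → ℕ) : Prop where
  min_tendsto : Tendsto (fun i => min (N i) (M i)) atTop atTop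
  ratio_tendsto : ∃ c : ℝ, 0 < c ∧ Tendsto (fun i => (N i : ℝ) / (M i : ℝ)) atTop (𝓝 c)

/-- The mean squared error of the `k`-sinusoid regression with parameters `θ` for the data `y` on
the `N × M` rectangle. -/
def loss {k : ℕ} (y : ℕ → ℕ → ℝ) (N M : ℕ) (θ : Params k) : ℝ :=
  1 / ((N : ℝ) * (M : ℝ)) *
    ∑ n ∈ Finset.range N, ∑ m ∈ Finset.range M, (y n m - ∑ i, sinusoid θ i n m) ^ 2

/-- `θ` is a least squares estimate in `Θ` from the data `y` on the `N × M` rectangle. -/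
def IsLeastSquaresEstimate {k : ℕ} (Θ : Set (Params k)) (y : ℕ → ℕ → ℝ) (N M : ℕ)
    (θ : Params k) : Prop :=
  θ ∈ Θ ∧ IsMinOn (loss y N M) Θ θ

end SinusoidLSE

end

open SinusoidLSE

/-!
Comparing the loss of an estimate `θ` with that of the dominant parameters `firstParams θ₀`, the
squares of the noise cancel. What remains is the mean square of the unexplained signal
`misfit θ₀ θ` and its correlation with the noise, so consistency splits into two parts.

*The noise.* Almost surely, the correlation of the noise with the sinusoids tends to zero uniformly
in frequency and phase (`DrivingField.ae_uniformlyOrthogonal`). The periodogram of the driving field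
is the Fourier series of its empirical autocovariances, hence bounded at all frequencies at once by
the sum of their moduli. At a non-zero lag the products of the field are orthogonal, so an
autocovariance over `N M` points is of order `(N M) ^ (1 / 2)`, and the whole bound of order
`(N M) ^ (3 / 2)` (`DrivingField.integral_lagBound_rect_le`). By the Cauchy–Schwarz inequality with
the weights `|a p|` this passes to the noise. Borel–Cantelli gives convergence along rectangles
whose sides are fourth powers, where the bounds are summable; other rectangles of bounded eccentricity
differ from these by parts of thin strips, whose contribution is controlled by second moments and
one further use of Borel–Cantelli.

*The signal.* Along an ultrafilter the estimates converge in the compact parameter space, and the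
limit `θ'` is shown to describe the dominant sinusoids (`sameSinusoids_of_tendsto`). Sinusoids whose
frequencies have different limits, up to sign and modulo `2π`, are asymptotically orthogonal. So
the true sinusoids whose frequency is not a limit frequency contribute their full power to the
misfit. At most `k` true sinusoids have a limit frequency, so minimality and the gap in the
amplitudes force these to be the `k` dominant ones. Then every single error
`wave (θ₀ i) - wave (θ l (σ i))` tends to zero in mean square. The frequencies may approach their
limits slowly compared with the size of the rectangles, so this does not give the phases by mere
continuity; the bound `one_sub_cos_corner_le` does, which controls the corner value of a linear
phase by its average.
-/

open scoped ENNReal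

namespace SinusoidLSE

/-! ### Averages of sinusoids over rectangles -/

/-- The average of `f` over the rectangle `{0, …, N - 1} × {0, …, M - 1}`. -/
noncomputable def rectAvg (N M : ℕ) (f : ℕ → ℕ → ℝ) : ℝ :=
  1 / ((N : ℝ) * (M : ℝ)) * ∑ n ∈ Finset.range N, ∑ m ∈ Finset.range M, f n m

theorem rectAvg_add (N M : ℕ) (f g : ℕ → ℕ → ℝ) :
    rectAvg N M (fun n m => f n m + g n m) = rectAvg N M f + rectAvg N M g := by
  simp only [rectAvg, Finset.sum_add_distrib, mul_add]

theorem rectAvg_const_mul (N M : ℕ) (c : ℝ) (f : ℕ → ℕ → ℝ) :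
    rectAvg N M (fun n m => c * f n m) = c * rectAvg N M f := by
  simp only [rectAvg, ← Finset.mul_sum]
  ring

theorem rectAvg_sub (N M : ℕ) (f g : ℕ → ℕ → ℝ) :
    rectAvg N M (fun n m => f n m - g n m) = rectAvg N M f - rectAvg N M g := by
  simp only [rectAvg, Finset.sum_sub_distrib, mul_sub]

theorem rectAvg_sum {κ : Type*} (N M : ℕ) (s : Finset κ) (f : κ → ℕ → ℕ → ℝ) :
    rectAvg N M (fun n m => ∑ j ∈ s, f j n m) = ∑ j ∈ s, rectAvg N M (f j) := by
  classical
  induction s using Finset.induction_on with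
  | empty => simp [rectAvg]
  | insert j s hj ih => simp only [Finset.sum_insert hj, rectAvg_add, ih]

theorem rectAvg_nonneg {N M : ℕ} {f : ℕ → ℕ → ℝ} (h : ∀ n m, 0 ≤ f n m) :
    0 ≤ rectAvg N M f :=
  mul_nonneg (by positivity) (Finset.sum_nonneg fun n _ => Finset.sum_nonneg fun m _ => h n m)

theorem rectAvg_const {N M : ℕ} (hN : N ≠ 0) (hM : M ≠ 0) (c : ℝ) :
    rectAvg N M (fun _ _ => c) = c := by
  have : (N : ℝ) ≠ 0 := by exact_mod_cast hN
  have : (M : ℝ) ≠ 0 := by exact_mod_cast hM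
  simp only [rectAvg, Finset.sum_const, Finset.card_range, nsmul_eq_mul]
  field_simp

/-- Away from `z = 1`, the geometric sums of a unimodular `z` stay bounded. -/
theorem norm_geom_sum_le {z : ℂ} (hz : ‖z‖ = 1) (N : ℕ) :
    ‖∑ n ∈ Finset.range N, z ^ n‖ * ‖z - 1‖ ≤ 2 := by
  rw [← norm_mul, geom_sum_mul]
  calc ‖z ^ N - 1‖ ≤ ‖z ^ N‖ + ‖(1 : ℂ)‖ := norm_sub_le _ _
    _ = 2 := by rw [norm_pow, hz]; norm_num

/-- The normalised Dirichlet kernel. -/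
noncomputable def dirichletMean (N : ℕ) (α : ℝ) : ℂ :=
  (N : ℂ)⁻¹ * ∑ n ∈ Finset.range N, Complex.exp (α * Complex.I) ^ n

theorem norm_dirichletMean_le_one (N : ℕ) (α : ℝ) : ‖dirichletMean N α‖ ≤ 1 := by
  rw [dirichletMean, norm_mul, norm_inv, Complex.norm_natCast]
  rcases Nat.eq_zero_or_pos N with rfl | hN
  · simp
  rw [inv_mul_le_iff₀ (by exact_mod_cast hN)]
  refine (norm_sum_le _ _).trans ?_
  simp [norm_pow, Complex.norm_exp_ofReal_mul_I]

theorem exp_mul_I_ne_one {α : ℝ} (h : Real.cos α ≠ 1) : Complex.exp (α * Complex.I) ≠ 1 := by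
  intro h1
  apply h
  rw [← Complex.exp_ofReal_mul_I_re, h1, Complex.one_re]

theorem tendsto_dirichletMean {ι : Type*} {F : Filter ι} {N : ι → ℕ} (hN : Tendsto N F atTop)
    {α : ι → ℝ} {α' : ℝ} (hα : Tendsto α F (𝓝 α')) (h : Real.cos α' ≠ 1) :
    Tendsto (fun l => ‖dirichletMean (N l) (α l)‖) F (𝓝 0) := by
  have hlim : Tendsto (fun l => ‖Complex.exp (α l * Complex.I) - 1‖) F
      (𝓝 ‖Complex.exp (α' * Complex.I) - 1‖) := by
    have hc : Continuous fun t : ℝ => ‖Complex.exp (t * Complex.I) - 1‖ := by fun_prop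
    exact (hc.tendsto α').comp hα
  have hpos : 0 < ‖Complex.exp (α' * Complex.I) - 1‖ :=
    norm_pos_iff.2 (sub_ne_zero.2 (exp_mul_I_ne_one h))
  have hNR : Tendsto (fun l => (N l : ℝ)⁻¹) F (𝓝 0) :=
    tendsto_inv_atTop_zero.comp (tendsto_natCast_atTop_atTop.comp hN)
  have hb : Tendsto (fun l => (N l : ℝ)⁻¹ * (2 / ‖Complex.exp (α l * Complex.I) - 1‖)) F (𝓝 0) := by
    simpa using hNR.mul (tendsto_const_nhds.div hlim hpos.ne')
  refine squeeze_zero' (Eventually.of_forall fun _ => norm_nonneg _) ?_ hb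
  filter_upwards [hlim.eventually (lt_mem_nhds hpos)] with l hl
  rw [dirichletMean, norm_mul, norm_inv, Complex.norm_natCast]
  gcongr
  rw [le_div_iff₀ hl]
  exact norm_geom_sum_le (Complex.norm_exp_ofReal_mul_I _) _

theorem rectAvg_cos_eq (N M : ℕ) (α β φ : ℝ) :
    rectAvg N M (fun n m => Real.cos (α * n + β * m + φ)) =
      (Complex.exp (φ * Complex.I) * (dirichletMean N α * dirichletMean M β)).re := by
  have h : Complex.exp (φ * Complex.I) * (dirichletMean N α * dirichletMean M β) =
      ((1 / ((N : ℝ) * (M : ℝ)) : ℝ) : ℂ) * ∑ n ∈ Finset.range N, ∑ m ∈ Finset.range M,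
        Complex.exp ((α * n + β * m + φ : ℝ) * Complex.I) := by
    rw [dirichletMean, dirichletMean]
    calc _ = ((N : ℂ)⁻¹ * (M : ℂ)⁻¹) * (((∑ n ∈ Finset.range N, Complex.exp (α * Complex.I) ^ n) *
          ∑ m ∈ Finset.range M, Complex.exp (β * Complex.I) ^ m) *
            Complex.exp (φ * Complex.I)) := by ring
      _ = _ := by
        rw [Finset.sum_mul_sum, Finset.sum_mul]
        congr 1
        · push_cast; rw [one_div, mul_inv]
        refine Finset.sum_congr rfl fun n _ => ?_
        rw [Finset.sum_mul]
        refine Finset.sum_congr rfl fun m _ => ?_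
        rw [← Complex.exp_nat_mul, ← Complex.exp_nat_mul, ← Complex.exp_add, ← Complex.exp_add]
        congr 1
        push_cast
        ring
  rw [h, Complex.re_ofReal_mul, Complex.re_sum, rectAvg]
  congr 1
  refine Finset.sum_congr rfl fun n _ => ?_
  rw [Complex.re_sum]
  exact Finset.sum_congr rfl fun m _ => (Complex.exp_ofReal_mul_I_re _).symm

/-- The averages of a sinusoid tend to zero, even with varying frequencies, as long as these
stay away from the zero frequency modulo `2π`. -/
theorem tendsto_rectAvg_cos {ι : Type*} {F : Filter ι} {N M : ι → ℕ} (hN : Tendsto N F atTop)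
    (hM : Tendsto M F atTop) {α β : ι → ℝ} (φ : ι → ℝ) {α' β' : ℝ} (hα : Tendsto α F (𝓝 α'))
    (hβ : Tendsto β F (𝓝 β')) (h : Real.cos α' ≠ 1 ∨ Real.cos β' ≠ 1) :
    Tendsto (fun l => rectAvg (N l) (M l) fun n m => Real.cos (α l * n + β l * m + φ l)) F
      (𝓝 0) := by
  have hle : ∀ l, ‖rectAvg (N l) (M l) fun n m => Real.cos (α l * n + β l * m + φ l)‖ ≤
      ‖dirichletMean (N l) (α l)‖ * ‖dirichletMean (M l) (β l)‖ := fun l => by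
    rw [rectAvg_cos_eq, Real.norm_eq_abs]
    refine (Complex.abs_re_le_norm _).trans ?_
    rw [norm_mul, norm_mul, Complex.norm_exp_ofReal_mul_I, one_mul]
  rcases h with h | h
  · refine squeeze_zero_norm (fun l => (hle l).trans ?_) (tendsto_dirichletMean hN hα h)
    exact mul_le_of_le_one_right (norm_nonneg _) (norm_dirichletMean_le_one _ _)
  · refine squeeze_zero_norm (fun l => (hle l).trans ?_) (tendsto_dirichletMean hM hβ h)
    exact mul_le_of_le_one_left (norm_nonneg _) (norm_dirichletMean_le_one _ _)

theorem abs_rectAvg_cos_le_one (N M : ℕ) (α β φ : ℝ) :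
    |rectAvg N M fun n m => Real.cos (α * n + β * m + φ)| ≤ 1 := by
  rw [rectAvg_cos_eq]
  refine (Complex.abs_re_le_norm _).trans ?_
  rw [norm_mul, norm_mul, Complex.norm_exp_ofReal_mul_I, one_mul]
  exact mul_le_one₀ (norm_dirichletMean_le_one _ _) (norm_nonneg _) (norm_dirichletMean_le_one _ _)

theorem one_sub_cos_two_mul_sub_le (a b : ℝ) :
    1 - Real.cos (2 * a - b) ≤ 8 * (1 - Real.cos a) + 2 * (1 - Real.cos b) := by
  have h2 : ∀ s t : ℝ, 1 - Real.cos (s - t) ≤ 2 * (1 - Real.cos s) + 2 * (1 - Real.cos t) := by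
    intro s t
    rw [Real.cos_sub]
    -- twice the difference of the sides is `(2 - cos s - cos t)² + (sin s + sin t)²`
    nlinarith [Real.sin_sq_add_cos_sq s, Real.sin_sq_add_cos_sq t,
      sq_nonneg (2 - Real.cos s - Real.cos t), sq_nonneg (Real.sin s + Real.sin t)]
  have h3 : 1 - Real.cos (2 * a) ≤ 4 * (1 - Real.cos a) := by
    rw [Real.cos_two_mul]
    nlinarith [sq_nonneg (1 - Real.cos a)]
  linarith [h2 (2 * a) b]

/-- If a linear phase is close to `0` modulo `2π` on average over a rectangle, then so is its value
at the corner: with `g` the phase, the corner value is `2 g (p) - g (2 p)` for every `p`, and both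
`p` and `2 p` stay in the rectangle when `p` runs through its lower left quarter. -/
theorem one_sub_cos_corner_le {N M : ℕ} (hN : N ≠ 0) (hM : M ≠ 0) (x y ψ : ℝ) :
    1 - Real.cos ψ ≤ 40 * rectAvg N M (fun n m => 1 - Real.cos (x * n + y * m + ψ)) := by
  set g : ℕ → ℕ → ℝ := fun n m => 1 - Real.cos (x * n + y * m + ψ) with hg
  have g0 : ∀ n m, 0 ≤ g n m := fun n m => sub_nonneg.2 (Real.cos_le_one _)
  set N' := (N + 1) / 2
  set M' := (M + 1) / 2
  -- `40 = 4 * (8 + 2)`, the factor `4` being the ratio of the areas of rectangle and quarter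
  have e1 : ∀ n m, 1 - Real.cos ψ ≤ 8 * g n m + 2 * g (2 * n) (2 * m) := by
    intro n m
    refine le_trans (le_of_eq ?_) (one_sub_cos_two_mul_sub_le _ _)
    congr 2
    push_cast
    ring
  have e2 : ∑ n ∈ Finset.range N', ∑ m ∈ Finset.range M', g n m ≤
      ∑ n ∈ Finset.range N, ∑ m ∈ Finset.range M, g n m := by
    refine (Finset.sum_le_sum fun n _ => Finset.sum_le_sum_of_subset_of_nonneg
      (Finset.range_mono (show M' ≤ M by omega)) fun m _ _ => g0 n m).trans ?_
    exact Finset.sum_le_sum_of_subset_of_nonneg (Finset.range_mono (show N' ≤ N by omega))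
      fun n _ _ => Finset.sum_nonneg fun m _ => g0 n m
  have e3 : ∀ (K : ℕ) (f : ℕ → ℝ), (∀ n, 0 ≤ f n) →
      ∑ n ∈ Finset.range ((K + 1) / 2), f (2 * n) ≤ ∑ n ∈ Finset.range K, f n := by
    intro K f hf
    rw [← Finset.sum_image (f := f) (s := Finset.range ((K + 1) / 2)) (g := fun n => 2 * n)
      (fun a _ b _ h => by simpa using h)]
    refine Finset.sum_le_sum_of_subset_of_nonneg (fun a ha => ?_) fun n _ _ => hf n
    simp only [Finset.mem_image, Finset.mem_range] at ha ⊢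
    omega
  have e4 : ∑ n ∈ Finset.range N', ∑ m ∈ Finset.range M', g (2 * n) (2 * m) ≤
      ∑ n ∈ Finset.range N, ∑ m ∈ Finset.range M, g n m :=
    (Finset.sum_le_sum fun n _ => e3 M _ (g0 _)).trans
      (e3 N (fun n => ∑ m ∈ Finset.range M, g n m) fun n => Finset.sum_nonneg fun m _ => g0 n m)
  have e5 : (N' : ℝ) * M' * (1 - Real.cos ψ) ≤
      10 * ∑ n ∈ Finset.range N, ∑ m ∈ Finset.range M, g n m := by
    have := Finset.sum_le_sum fun n (_ : n ∈ Finset.range N') =>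
      Finset.sum_le_sum fun m (_ : m ∈ Finset.range M') => e1 n m
    simp only [Finset.sum_const, Finset.card_range, nsmul_eq_mul, Finset.sum_add_distrib,
      ← Finset.mul_sum] at this
    linarith
  have hN0 : (0 : ℝ) < N := by exact_mod_cast Nat.pos_of_ne_zero hN
  have hM0 : (0 : ℝ) < M := by exact_mod_cast Nat.pos_of_ne_zero hM
  have hN' : (N : ℝ) ≤ 2 * N' := by exact_mod_cast (show N ≤ 2 * N' by omega)
  have hM' : (M : ℝ) ≤ 2 * M' := by exact_mod_cast (show M ≤ 2 * M' by omega)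
  have e6 : (N : ℝ) * M ≤ 4 * (N' * M') := by
    nlinarith [mul_le_mul hN' hM' hM0.le (by positivity)]
  have e7 : (N : ℝ) * M * (1 - Real.cos ψ) ≤
      40 * ∑ n ∈ Finset.range N, ∑ m ∈ Finset.range M, g n m := by
    have := mul_le_mul_of_nonneg_right e6 (sub_nonneg.2 (Real.cos_le_one ψ))
    linarith
  rw [rectAvg, one_div, ← mul_assoc, mul_comm (40 : ℝ), mul_assoc, le_inv_mul_iff₀ (by positivity)]
  exact e7

/-! ### Identification of a single sinusoid -/

/-- The real sinusoid on the lattice with amplitude, frequencies and phase `p = (ρ, ω, υ, φ)`. -/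
noncomputable def wave (p : ℝ × ℝ × ℝ × ℝ) (n m : ℕ) : ℝ :=
  p.1 * Real.cos (p.2.1 * n + p.2.2.1 * m + p.2.2.2)

/-- The frequency pair of `p` lies in `(0, 2π) × (0, 2π)`. -/
def InBox (p : ℝ × ℝ × ℝ × ℝ) : Prop :=
  p.2.1 ∈ Set.Ioo 0 (2 * Real.pi) ∧ p.2.2.1 ∈ Set.Ioo 0 (2 * Real.pi)

/-- Two frequency pairs in `(0, 2π) × (0, 2π)` agree as frequencies of real sinusoids on the
lattice, that is, up to sign and modulo `2π`. -/
def Aliased (p q : ℝ × ℝ × ℝ × ℝ) : Prop :=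
  (p.2.1 = q.2.1 ∧ p.2.2.1 = q.2.2.1) ∨
    (p.2.1 + q.2.1 = 2 * Real.pi ∧ p.2.2.1 + q.2.2.1 = 2 * Real.pi)

theorem Aliased.symm {p q : ℝ × ℝ × ℝ × ℝ} (h : Aliased p q) : Aliased q p := by
  rcases h with ⟨h1, h2⟩ | ⟨h1, h2⟩
  · exact Or.inl ⟨h1.symm, h2.symm⟩
  · exact Or.inr ⟨by linarith, by linarith⟩

theorem Aliased.trans {p q r : ℝ × ℝ × ℝ × ℝ} (h : Aliased p q) (h' : Aliased q r) :
    Aliased p r := by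
  rcases h with ⟨h1, h2⟩ | ⟨h1, h2⟩ <;> rcases h' with ⟨h3, h4⟩ | ⟨h3, h4⟩
  · exact Or.inl ⟨by linarith, by linarith⟩
  · exact Or.inr ⟨by linarith, by linarith⟩
  · exact Or.inr ⟨by linarith, by linarith⟩
  · exact Or.inl ⟨by linarith, by linarith⟩

theorem wave_mul_wave (p q : ℝ × ℝ × ℝ × ℝ) (n m : ℕ) :
    wave p n m * wave q n m = p.1 * q.1 / 2 *
      (Real.cos ((p.2.1 - q.2.1) * n + (p.2.2.1 - q.2.2.1) * m + (p.2.2.2 - q.2.2.2)) +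
        Real.cos ((p.2.1 + q.2.1) * n + (p.2.2.1 + q.2.2.1) * m + (p.2.2.2 + q.2.2.2))) := by
  have e1 : (p.2.1 - q.2.1) * n + (p.2.2.1 - q.2.2.1) * m + (p.2.2.2 - q.2.2.2) =
      (p.2.1 * n + p.2.2.1 * m + p.2.2.2) - (q.2.1 * n + q.2.2.1 * m + q.2.2.2) := by ring
  have e2 : (p.2.1 + q.2.1) * n + (p.2.2.1 + q.2.2.1) * m + (p.2.2.2 + q.2.2.2) =
      (p.2.1 * n + p.2.2.1 * m + p.2.2.2) + (q.2.1 * n + q.2.2.1 * m + q.2.2.2) := by ring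
  rw [e1, e2, Real.cos_sub, Real.cos_add (p.2.1 * n + p.2.2.1 * m + p.2.2.2), wave, wave]
  ring

theorem rectAvg_wave_mul_wave (N M : ℕ) (p q : ℝ × ℝ × ℝ × ℝ) :
    rectAvg N M (fun n m => wave p n m * wave q n m) = p.1 * q.1 / 2 *
      (rectAvg N M (fun n m => Real.cos ((p.2.1 - q.2.1) * n + (p.2.2.1 - q.2.2.1) * m +
          (p.2.2.2 - q.2.2.2))) +
        rectAvg N M (fun n m => Real.cos ((p.2.1 + q.2.1) * n + (p.2.2.1 + q.2.2.1) * m +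
          (p.2.2.2 + q.2.2.2)))) := by
  simp only [wave_mul_wave, rectAvg_const_mul, rectAvg_add]

theorem cos_sub_ne_one {x y : ℝ} (hx : x ∈ Set.Ioo 0 (2 * Real.pi))
    (hy : y ∈ Set.Ioo 0 (2 * Real.pi)) (h : x ≠ y) : Real.cos (x - y) ≠ 1 := by
  rw [Ne, Real.cos_eq_one_iff_of_lt_of_lt (by linarith [hx.1, hy.2]) (by linarith [hx.2, hy.1])]
  exact sub_ne_zero.2 h

theorem cos_add_ne_one {x y : ℝ} (hx : x ∈ Set.Ioo 0 (2 * Real.pi))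
    (hy : y ∈ Set.Ioo 0 (2 * Real.pi)) (h : x + y ≠ 2 * Real.pi) : Real.cos (x + y) ≠ 1 := by
  rw [← Real.cos_sub_two_pi, Ne,
    Real.cos_eq_one_iff_of_lt_of_lt (by linarith [hx.1, hy.1]) (by linarith [hx.2, hy.2])]
  exact sub_ne_zero.2 h

section Limits

variable {ι : Type*} {F : Filter ι} {N M : ι → ℕ}

theorem tendsto_rectAvg_sum_freq (hN : Tendsto N F atTop) (hM : Tendsto M F atTop)
    {p q : ι → ℝ × ℝ × ℝ × ℝ} {p' q' : ℝ × ℝ × ℝ × ℝ} (hp : Tendsto p F (𝓝 p'))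
    (hq : Tendsto q F (𝓝 q')) (bp : InBox p') (bq : InBox q')
    (h : p'.2.1 + q'.2.1 ≠ 2 * Real.pi ∨ p'.2.2.1 + q'.2.2.1 ≠ 2 * Real.pi) :
    Tendsto (fun l => rectAvg (N l) (M l) fun n m =>
      Real.cos (((p l).2.1 + (q l).2.1) * n + ((p l).2.2.1 + (q l).2.2.1) * m +
        ((p l).2.2.2 + (q l).2.2.2))) F (𝓝 0) :=
  tendsto_rectAvg_cos hN hM (fun l => (p l).2.2.2 + (q l).2.2.2)
    (hp.snd_nhds.fst_nhds.add hq.snd_nhds.fst_nhds)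
    (hp.snd_nhds.snd_nhds.fst_nhds.add hq.snd_nhds.snd_nhds.fst_nhds)
    (h.imp (cos_add_ne_one bp.1 bq.1) (cos_add_ne_one bp.2 bq.2))

/-- Sinusoids whose frequencies have different limits are asymptotically orthogonal. -/
theorem tendsto_rectAvg_wave_mul_wave (hN : Tendsto N F atTop) (hM : Tendsto M F atTop)
    {p q : ι → ℝ × ℝ × ℝ × ℝ} {p' q' : ℝ × ℝ × ℝ × ℝ} (hp : Tendsto p F (𝓝 p'))
    (hq : Tendsto q F (𝓝 q')) (bp : InBox p') (bq : InBox q') (h : ¬ Aliased p' q') :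
    Tendsto (fun l => rectAvg (N l) (M l) fun n m => wave (p l) n m * wave (q l) n m) F (𝓝 0) := by
  rw [Aliased, not_or, not_and_or, not_and_or] at h
  have h1 := tendsto_rectAvg_cos hN hM (fun l => (p l).2.2.2 - (q l).2.2.2)
    (hp.snd_nhds.fst_nhds.sub hq.snd_nhds.fst_nhds)
    (hp.snd_nhds.snd_nhds.fst_nhds.sub hq.snd_nhds.snd_nhds.fst_nhds)
    (h.1.imp (cos_sub_ne_one bp.1 bq.1) (cos_sub_ne_one bp.2 bq.2))
  have h2 := tendsto_rectAvg_sum_freq hN hM hp hq bp bq h.2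
  simpa [rectAvg_wave_mul_wave] using
    ((hp.fst_nhds.mul hq.fst_nhds).div_const 2).mul (h1.add h2)

/-- The mean power of a sinusoid of amplitude `ρ` is `ρ ^ 2 / 2`, except at the frequency `(π, π)`,
which is its own negative. -/
theorem tendsto_rectAvg_wave_sq (hN : Tendsto N F atTop) (hM : Tendsto M F atTop)
    {p : ι → ℝ × ℝ × ℝ × ℝ} {p' : ℝ × ℝ × ℝ × ℝ} (hp : Tendsto p F (𝓝 p')) (bp : InBox p')
    (h : p'.2.1 + p'.2.1 ≠ 2 * Real.pi ∨ p'.2.2.1 + p'.2.2.1 ≠ 2 * Real.pi) :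
    Tendsto (fun l => rectAvg (N l) (M l) fun n m => wave (p l) n m * wave (p l) n m) F
      (𝓝 (p'.1 ^ 2 / 2)) := by
  have h2 := tendsto_rectAvg_sum_freq hN hM hp hp bp bp h
  have h1 : Tendsto (fun l => rectAvg (N l) (M l) fun _ _ => 1) F (𝓝 1) := by
    refine tendsto_const_nhds.congr' ?_
    filter_upwards [hN.eventually_gt_atTop 0, hM.eventually_gt_atTop 0] with l a b
    rw [rectAvg_const a.ne' b.ne']
  have h3 := ((hp.fst_nhds.mul hp.fst_nhds).div_const 2).mul (h1.add h2)
  simp only [add_zero, mul_one, ← sq p'.1] at h3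
  simpa [rectAvg_wave_mul_wave] using h3

/-- A sinusoid whose parameters converge, with limit frequency that of `q`, and whose mean squared
distance to `wave q` tends to zero, has the amplitude and the phase of `q` in the limit. -/
theorem amp_eq_and_cos_phase_eq_one [F.NeBot] (hN : Tendsto N F atTop) (hM : Tendsto M F atTop)
    {p : ι → ℝ × ℝ × ℝ × ℝ} {p' q : ℝ × ℝ × ℝ × ℝ} (hp : Tendsto p F (𝓝 p')) (bq : InBox q)
    (hq : ¬ (q.2.1 + q.2.1 = 2 * Real.pi ∧ q.2.2.1 + q.2.2.1 = 2 * Real.pi))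
    (h1 : p'.2.1 = q.2.1) (h2 : p'.2.2.1 = q.2.2.1) (hp0 : 0 ≤ p'.1) (hq0 : 0 < q.1)
    (h : Tendsto (fun l => rectAvg (N l) (M l) fun n m =>
      (wave q n m - wave (p l) n m) * (wave q n m - wave (p l) n m)) F (𝓝 0)) :
    p'.1 = q.1 ∧ Real.cos (p'.2.2.2 - q.2.2.2) = 1 := by
  rw [not_and_or] at hq
  have bp : InBox p' := by unfold InBox; rw [h1, h2]; exact bq
  -- `c l` is the mean of the cosine of the phase difference; it has to tend to `1`
  set c : ι → ℝ := fun l => rectAvg (N l) (M l) fun n m =>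
    Real.cos (((p l).2.1 - q.2.1) * n + ((p l).2.2.1 - q.2.2.1) * m + ((p l).2.2.2 - q.2.2.2))
    with hc
  have a1 := tendsto_rectAvg_wave_sq hN hM hp bp (by rw [h1, h2]; exact hq)
  have a2 := tendsto_rectAvg_wave_sq (F := F) hN hM (tendsto_const_nhds (x := q)) bq hq
  have a3 := tendsto_rectAvg_sum_freq hN hM hp (tendsto_const_nhds (x := q)) bp bq
    (by rw [h1, h2]; exact hq)
  have a4 := ((hp.fst_nhds.mul_const q.1).div_const 2).mul a3
  have key : Tendsto (fun l => (p l).1 * q.1 * c l) F (𝓝 ((p'.1 ^ 2 + q.1 ^ 2) / 2)) := by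
    have := ((a1.add a2).sub h).sub (a4.const_mul 2)
    simp only [mul_zero, sub_zero, ← add_div] at this
    refine this.congr fun l => ?_
    have e : (fun n m => (wave q n m - wave (p l) n m) * (wave q n m - wave (p l) n m)) =
        fun n m => (wave q n m * wave q n m + wave (p l) n m * wave (p l) n m) +
          (-2) * (wave (p l) n m * wave q n m) := by
      funext n m; ring
    rw [e, rectAvg_add, rectAvg_add, rectAvg_const_mul, rectAvg_wave_mul_wave (p := p l) (q := q)]
    simp only [hc]
    ring
  have c1 : ∀ l, |c l| ≤ 1 := fun l => abs_rectAvg_cos_le_one _ _ _ _ _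
  have hle : (p'.1 ^ 2 + q.1 ^ 2) / 2 ≤ |p'.1| * q.1 := by
    refine le_of_tendsto_of_tendsto' key (hp.fst_nhds.abs.mul_const q.1) fun l => ?_
    calc (p l).1 * q.1 * c l ≤ |(p l).1 * q.1 * c l| := le_abs_self _
      _ = |(p l).1| * q.1 * |c l| := by rw [abs_mul, abs_mul, abs_of_pos hq0]
      _ ≤ |(p l).1| * q.1 := mul_le_of_le_one_right (by positivity) (c1 l)
  rw [abs_of_nonneg hp0] at hle
  have heq : p'.1 = q.1 := by
    have : (p'.1 - q.1) ^ 2 ≤ 0 := by linarith [sub_sq p'.1 q.1]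
    exact sub_eq_zero.1 (pow_eq_zero_iff two_ne_zero |>.1 (le_antisymm this (sq_nonneg _)))
  refine ⟨heq, ?_⟩
  have hpq : Tendsto (fun l => (p l).1 * q.1) F (𝓝 (p'.1 * q.1)) := hp.fst_nhds.mul_const _
  have hpos : 0 < p'.1 * q.1 := by rw [heq]; positivity
  have hc1 : Tendsto c F (𝓝 1) := by
    have := key.div hpq hpos.ne'
    rw [heq, show (q.1 ^ 2 + q.1 ^ 2) / 2 / (q.1 * q.1) = 1 by field_simp; norm_num] at this
    refine this.congr' ?_
    filter_upwards [hpq.eventually (lt_mem_nhds hpos)] with l hl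
    exact mul_div_cancel_left₀ _ hl.ne'
  have b1 : Tendsto (fun l => 40 * (1 - c l)) F (𝓝 0) := by
    simpa using (hc1.const_sub 1).const_mul 40
  have b2 : Tendsto (fun l => 1 - Real.cos ((p l).2.2.2 - q.2.2.2)) F
      (𝓝 (1 - Real.cos (p'.2.2.2 - q.2.2.2))) :=
    ((Real.continuous_cos.tendsto _).comp
      (hp.snd_nhds.snd_nhds.snd_nhds.sub_const _)).const_sub 1
  have b3 := le_of_tendsto_of_tendsto b2 b1 (by
    filter_upwards [hN.eventually_gt_atTop 0, hM.eventually_gt_atTop 0] with l ha hb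
    refine (one_sub_cos_corner_le ha.ne' hb.ne' ((p l).2.1 - q.2.1)
      ((p l).2.2.1 - q.2.2.1) _).trans (le_of_eq ?_)
    rw [rectAvg_sub, rectAvg_const ha.ne' hb.ne'])
  linarith [Real.cos_le_one (p'.2.2.2 - q.2.2.2)]

theorem wave_eq_of_cos_phase_eq_one {p q : ℝ × ℝ × ℝ × ℝ} (h0 : p.1 = q.1) (h1 : p.2.1 = q.2.1)
    (h2 : p.2.2.1 = q.2.2.1) (h3 : Real.cos (p.2.2.2 - q.2.2.2) = 1) : wave p = wave q := by
  obtain ⟨z, hz⟩ := (Real.cos_eq_one_iff _).1 h3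
  funext n m
  rw [wave, wave, h0, h1, h2, show q.2.1 * n + q.2.2.1 * m + p.2.2.2 =
    q.2.1 * n + q.2.2.1 * m + q.2.2.2 + z * (2 * Real.pi) by linarith, Real.cos_add_int_mul_two_pi]

/-- The parameters of the same sinusoid with the opposite amplitude. -/
noncomputable def negAmp (p : ℝ × ℝ × ℝ × ℝ) : ℝ × ℝ × ℝ × ℝ :=
  (-p.1, p.2.1, p.2.2.1, p.2.2.2 + Real.pi)

theorem wave_negAmp (p : ℝ × ℝ × ℝ × ℝ) : wave (negAmp p) = wave p := by
  funext n m
  simp only [wave, negAmp, ← add_assoc, Real.cos_add_pi]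
  ring

/-- The parameters of the same sinusoid with the opposite frequencies, modulo `2π`. -/
noncomputable def negFreq (p : ℝ × ℝ × ℝ × ℝ) : ℝ × ℝ × ℝ × ℝ :=
  (p.1, 2 * Real.pi - p.2.1, 2 * Real.pi - p.2.2.1, -p.2.2.2)

theorem wave_negFreq (p : ℝ × ℝ × ℝ × ℝ) : wave (negFreq p) = wave p := by
  funext n m
  simp only [wave, negFreq]
  rw [← Real.cos_neg (p.2.1 * n + p.2.2.1 * m + p.2.2.2),
    ← Real.cos_add_nat_mul_two_pi (-(p.2.1 * n + p.2.2.1 * m + p.2.2.2)) (n + m)]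
  congr 2
  push_cast
  ring

/-- Identification of one sinusoid: if the mean squared distance to `wave q` of a sinusoid with
converging parameters tends to zero, and the limit frequency is that of `q` up to aliasing, then
the limit parameters describe `wave q`. -/
theorem wave_eq_of_tendsto [F.NeBot] (hN : Tendsto N F atTop) (hM : Tendsto M F atTop)
    {p : ι → ℝ × ℝ × ℝ × ℝ} {p' q : ℝ × ℝ × ℝ × ℝ} (hp : Tendsto p F (𝓝 p')) (bq : InBox q)
    (hq : ¬ (q.2.1 + q.2.1 = 2 * Real.pi ∧ q.2.2.1 + q.2.2.1 = 2 * Real.pi))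
    (hal : Aliased p' q) (hq0 : 0 < q.1)
    (h : Tendsto (fun l => rectAvg (N l) (M l) fun n m =>
      (wave q n m - wave (p l) n m) * (wave q n m - wave (p l) n m)) F (𝓝 0)) :
    wave p' = wave q := by
  have main : ∀ (p : ι → ℝ × ℝ × ℝ × ℝ) (p' : ℝ × ℝ × ℝ × ℝ), Tendsto p F (𝓝 p') →
      p'.2.1 = q.2.1 → p'.2.2.1 = q.2.2.1 → Tendsto (fun l => rectAvg (N l) (M l) fun n m =>
      (wave q n m - wave (p l) n m) * (wave q n m - wave (p l) n m)) F (𝓝 0) →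
      wave p' = wave q := by
    intro p p' hp h1 h2 h
    rcases le_total 0 p'.1 with h0 | h0
    · obtain ⟨e1, e2⟩ := amp_eq_and_cos_phase_eq_one hN hM hp bq hq h1 h2 h0 hq0 h
      exact wave_eq_of_cos_phase_eq_one e1 h1 h2 e2
    · have hcont : Continuous negAmp := by unfold negAmp; fun_prop
      obtain ⟨e1, e2⟩ := amp_eq_and_cos_phase_eq_one (p := fun l => negAmp (p l)) hN hM
        ((hcont.tendsto p').comp hp) bq hq h1 h2 (neg_nonneg.2 h0) hq0
        (by simpa only [wave_negAmp] using h)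
      rw [← wave_negAmp]
      exact wave_eq_of_cos_phase_eq_one e1 h1 h2 e2
  rcases hal with ⟨h1, h2⟩ | ⟨h1, h2⟩
  · exact main p p' hp h1 h2 h
  · have hcont : Continuous negFreq := by unfold negFreq; fun_prop
    rw [← wave_negFreq]
    refine main (fun l => negFreq (p l)) _ ((hcont.tendsto p').comp hp) ?_ ?_
      (by simpa only [wave_negFreq] using h)
    · simp only [negFreq]; linarith
    · simp only [negFreq]; linarith

end Limits

/-! ### Consistency for a fixed noise field -/

theorem rectAvg_sum_mul_sum {κ κ' : Type*} (N M : ℕ) (s : Finset κ) (t : Finset κ')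
    (f : κ → ℕ → ℕ → ℝ) (g : κ' → ℕ → ℕ → ℝ) :
    rectAvg N M (fun n m => (∑ i ∈ s, f i n m) * ∑ j ∈ t, g j n m) =
      ∑ i ∈ s, ∑ j ∈ t, rectAvg N M (fun n m => f i n m * g j n m) := by
  simp only [Finset.sum_mul_sum, rectAvg_sum]

/-- A set of at most `k` indices whose complement carries no more power than that of the first `k`
indices consists of the first `k` indices. -/
theorem eq_filter_of_sum_compl_le {P k : ℕ} (hkP : k < P) {ρ : Fin P → ℝ} (hanti : Antitone ρ)
    (hgap : ∀ i j : Fin P, (i : ℕ) < k → k ≤ (j : ℕ) → ρ j < ρ i) (hpos : ∀ i, 0 < ρ i)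
    {T : Finset (Fin P)} (hT : T.card ≤ k)
    (hsum : ∑ j ∈ Tᶜ, ρ j ^ 2 ≤ ∑ j ∈ Finset.univ.filter (fun j : Fin P => k ≤ (j : ℕ)), ρ j ^ 2) :
    T = Finset.univ.filter (fun j : Fin P => (j : ℕ) < k) := by
  set T₀ := Finset.univ.filter (fun j : Fin P => (j : ℕ) < k) with hT₀
  have hcard : T₀.card = k := by
    have : T₀ = Finset.univ.map (Fin.castLEEmb hkP.le) := by
      ext j
      simp only [hT₀, Finset.mem_filter, Finset.mem_univ, true_and, Finset.mem_map,
        Fin.castLEEmb_apply]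
      exact ⟨fun h => ⟨⟨j, h⟩, rfl⟩, fun ⟨i, hi⟩ => hi ▸ i.2⟩
    rw [this, Finset.card_map, Finset.card_univ, Fintype.card_fin]
  have hc : Finset.univ.filter (fun j : Fin P => k ≤ (j : ℕ)) = T₀ᶜ := by
    ext j; simp [hT₀]
  rw [hc] at hsum
  by_contra hne
  have hnsub : ¬ T₀ ⊆ T := fun h =>
    hne (Finset.eq_of_subset_of_card_le h (hT.trans hcard.ge)).symm
  obtain ⟨j₀, hj₀, hj₀'⟩ := Finset.not_subset.1 hnsub
  have hk : (j₀ : ℕ) < k := by simpa [hT₀] using hj₀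
  -- the smallest of the dominant amplitudes
  set c := ρ ⟨k - 1, by omega⟩ with hcdef
  have hcle : ∀ j ∈ T₀ \ T, c ^ 2 ≤ ρ j ^ 2 := by
    intro j hj
    have hj' : (j : ℕ) < k := by simpa [hT₀] using (Finset.mem_sdiff.1 hj).1
    exact pow_le_pow_left₀ (hpos _).le (hanti (Fin.le_def.2 (by simp; omega))) 2
  have hclt : ∀ j ∈ T \ T₀, ρ j ^ 2 < c ^ 2 := by
    intro j hj
    have hj' : k ≤ (j : ℕ) := by simpa [hT₀] using (Finset.mem_sdiff.1 hj).2
    exact pow_lt_pow_left₀ (hgap _ _ (by simp; omega) hj') (hpos _).le two_ne_zero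
  have hcards : ((T \ T₀).card : ℝ) ≤ (T₀ \ T).card := by
    have h1 := Finset.card_sdiff_add_card_inter T T₀
    have h2 := Finset.card_sdiff_add_card_inter T₀ T
    rw [Finset.inter_comm] at h2
    exact_mod_cast (show (T \ T₀).card ≤ (T₀ \ T).card by omega)
  have hle : ∑ j ∈ T₀ \ T, ρ j ^ 2 ≤ ∑ j ∈ T \ T₀, ρ j ^ 2 := by
    have h1 := Finset.sum_add_sum_compl T fun j => ρ j ^ 2
    have h2 := Finset.sum_add_sum_compl T₀ fun j => ρ j ^ 2
    have h3 := Finset.sum_inter_add_sum_sdiff T T₀ fun j => ρ j ^ 2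
    have h4 := Finset.sum_inter_add_sum_sdiff T₀ T fun j => ρ j ^ 2
    rw [Finset.inter_comm] at h4
    linarith
  have hlow : ((T₀ \ T).card : ℝ) * c ^ 2 ≤ ∑ j ∈ T₀ \ T, ρ j ^ 2 := by
    simpa using Finset.card_nsmul_le_sum _ _ _ hcle
  have hc0 : 0 < c ^ 2 := pow_pos (hpos _) 2
  have hup : ∑ j ∈ T \ T₀, ρ j ^ 2 < ((T₀ \ T).card : ℝ) * c ^ 2 := by
    rcases (T \ T₀).eq_empty_or_nonempty with h | h
    · rw [h, Finset.sum_empty]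
      have : 0 < (T₀ \ T).card := Finset.card_pos.2 ⟨j₀, Finset.mem_sdiff.2 ⟨hj₀, hj₀'⟩⟩
      positivity
    · calc ∑ j ∈ T \ T₀, ρ j ^ 2 < ∑ j ∈ T \ T₀, c ^ 2 := Finset.sum_lt_sum_of_nonempty h hclt
        _ = ((T \ T₀).card : ℝ) * c ^ 2 := by simp
        _ ≤ _ := by gcongr
  linarith

section Consistency

variable {ι : Type*} {F : Filter ι} {N M : ι → ℕ}

/-- The field `w` is asymptotically orthogonal to all sinusoids, uniformly in their frequencies and
phases. -/
def UniformlyOrthogonal (F : Filter ι) (N M : ι → ℕ) (w : ℕ → ℕ → ℝ) : Prop :=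
  ∀ ε > 0, ∀ᶠ l in F, ∀ α β φ : ℝ,
    |rectAvg (N l) (M l) fun n m => w n m * Real.cos (α * n + β * m + φ)| ≤ ε

theorem UniformlyOrthogonal.tendsto_wave {w : ℕ → ℕ → ℝ} (hw : UniformlyOrthogonal F N M w)
    {p : ι → ℝ × ℝ × ℝ × ℝ} {p' : ℝ × ℝ × ℝ × ℝ} (hp : Tendsto p F (𝓝 p')) :
    Tendsto (fun l => rectAvg (N l) (M l) fun n m => w n m * wave (p l) n m) F (𝓝 0) := by
  have h1 : Tendsto (fun l => rectAvg (N l) (M l) fun n m =>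
      w n m * Real.cos ((p l).2.1 * n + (p l).2.2.1 * m + (p l).2.2.2)) F (𝓝 0) := by
    rw [Metric.tendsto_nhds]
    intro ε hε
    filter_upwards [hw (ε / 2) (by positivity)] with l hl
    rw [Real.dist_0_eq_abs]
    exact (hl _ _ _).trans_lt (by linarith)
  have h2 := hp.fst_nhds.mul h1
  rw [mul_zero] at h2
  refine h2.congr fun l => ?_
  rw [← rectAvg_const_mul]
  congr 1
  funext n m
  rw [wave]
  ring

variable {P k : ℕ} {θ₀ : Params P}

theorem DistinctFrequencies.inBox (h : DistinctFrequencies θ₀) (j : Fin P) : InBox (θ₀ j) :=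
  ⟨h.freq₁_mem j, h.freq₂_mem j⟩

theorem DistinctFrequencies.not_self (h : DistinctFrequencies θ₀) (j : Fin P) :
    ¬ ((θ₀ j).2.1 + (θ₀ j).2.1 = 2 * Real.pi ∧ (θ₀ j).2.2.1 + (θ₀ j).2.2.1 = 2 * Real.pi) :=
  not_and_or.2 (h.ne_neg j j)

theorem DistinctFrequencies.eq_of_aliased (h : DistinctFrequencies θ₀) {i j : Fin P}
    (hij : Aliased (θ₀ i) (θ₀ j)) : i = j := by
  by_contra hne
  rcases hij with hij | hij
  · exact not_and_or.2 (h.ne i j hne) hij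
  · exact not_and_or.2 (h.ne_neg i j) hij

/-- The mean power of a sum of true sinusoids is the sum of their powers. -/
theorem DistinctFrequencies.tendsto_power (h : DistinctFrequencies θ₀) (hN : Tendsto N F atTop)
    (hM : Tendsto M F atTop) (s : Finset (Fin P)) :
    Tendsto (fun l => rectAvg (N l) (M l) fun n m =>
      (∑ j ∈ s, wave (θ₀ j) n m) * ∑ j ∈ s, wave (θ₀ j) n m) F
      (𝓝 (∑ j ∈ s, amp θ₀ j ^ 2 / 2)) := by
  classical
  simp only [rectAvg_sum_mul_sum]
  refine tendsto_finsetSum _ fun i hi => ?_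
  have : amp θ₀ i ^ 2 / 2 = ∑ j ∈ s, if i = j then amp θ₀ i ^ 2 / 2 else 0 := by
    rw [Finset.sum_ite_eq, if_pos hi]
  rw [this]
  refine tendsto_finsetSum _ fun j _ => ?_
  split_ifs with hij
  · subst hij
    exact tendsto_rectAvg_wave_sq hN hM (p := fun _ => θ₀ i) tendsto_const_nhds (h.inBox i)
      (not_and_or.1 (h.not_self i))
  · exact tendsto_rectAvg_wave_mul_wave hN hM (p := fun _ => θ₀ i) (q := fun _ => θ₀ j)
      tendsto_const_nhds tendsto_const_nhds (h.inBox i) (h.inBox j)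
      fun hal => hij (h.eq_of_aliased hal)

/-- The part of the true signal that the regression with parameters `θ` does not explain. -/
noncomputable def misfit (θ₀ : Params P) (θ : Params k) (n m : ℕ) : ℝ :=
  ∑ j, wave (θ₀ j) n m - ∑ i, wave (θ i) n m

theorem misfit_firstParams (hkP : k ≤ P) (n m : ℕ) :
    misfit θ₀ (firstParams hkP θ₀) n m =
      ∑ j ∈ Finset.univ.filter (fun j : Fin P => k ≤ (j : ℕ)), wave (θ₀ j) n m := by
  have h1 : ∑ i, wave (firstParams hkP θ₀ i) n m =
      ∑ j ∈ Finset.univ.filter (fun j : Fin P => (j : ℕ) < k), wave (θ₀ j) n m := by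
    have : Finset.univ.filter (fun j : Fin P => (j : ℕ) < k) =
        Finset.univ.map (Fin.castLEEmb hkP) := by
      ext j
      simp only [Finset.mem_filter, Finset.mem_univ, true_and, Finset.mem_map,
        Fin.castLEEmb_apply]
      exact ⟨fun h => ⟨⟨j, h⟩, rfl⟩, fun ⟨i, hi⟩ => hi ▸ i.2⟩
    rw [this, Finset.sum_map]
    rfl
  rw [misfit, h1, ← Finset.sum_filter_add_sum_filter_not Finset.univ (fun j : Fin P => (j : ℕ) < k)]
  simp only [not_lt]
  ring

theorem loss_eq (θ₀ : Params P) (θ : Params k) (w : ℕ → ℕ → ℝ) (N M : ℕ) :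
    loss (fun n m => (∑ j, sinusoid θ₀ j n m) + w n m) N M θ =
      rectAvg N M (fun n m => misfit θ₀ θ n m * misfit θ₀ θ n m) +
        2 * rectAvg N M (fun n m => w n m * misfit θ₀ θ n m) +
          rectAvg N M (fun n m => w n m * w n m) := by
  rw [← rectAvg_const_mul, ← rectAvg_add, ← rectAvg_add]
  unfold loss rectAvg
  congr 1
  refine Finset.sum_congr rfl fun n _ => Finset.sum_congr rfl fun m _ => ?_
  simp only [misfit, sinusoid, wave, amp, freq₁, freq₂, phase]
  ring

theorem UniformlyOrthogonal.tendsto_misfit {w : ℕ → ℕ → ℝ} (hw : UniformlyOrthogonal F N M w)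
    {θ : ι → Params k} {θ' : Params k} (hθ : Tendsto θ F (𝓝 θ')) :
    Tendsto (fun l => rectAvg (N l) (M l) fun n m => w n m * misfit θ₀ (θ l) n m) F (𝓝 0) := by
  simp only [misfit, mul_sub, Finset.mul_sum, rectAvg_sub, rectAvg_sum]
  have h1 := tendsto_finsetSum Finset.univ fun j (_ : j ∈ Finset.univ) =>
    hw.tendsto_wave (p := fun _ => θ₀ j) tendsto_const_nhds
  have h2 := tendsto_finsetSum Finset.univ fun i (_ : i ∈ Finset.univ) =>
    hw.tendsto_wave (p := fun l => θ l i) (tendsto_pi_nhds.1 hθ i)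
  simpa using h1.sub h2

/-- Every cluster point of the least squares estimates describes the dominant sinusoids, if the
noise is asymptotically orthogonal to all sinusoids. -/
theorem sameSinusoids_of_tendsto [F.NeBot] (hN : Tendsto N F atTop) (hM : Tendsto M F atTop)
    (hkP : k < P) (hfreq : DistinctFrequencies θ₀) (hamp : DominantFirst k θ₀) {w : ℕ → ℕ → ℝ}
    (hw : UniformlyOrthogonal F N M w) {θ : ι → Params k} {θ' : Params k}
    (hθ : Tendsto θ F (𝓝 θ')) (hbox : ∀ i, InBox (θ' i))
    (hloss : ∀ᶠ l in F,
      loss (fun n m => (∑ j, sinusoid θ₀ j n m) + w n m) (N l) (M l) (θ l) ≤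
        loss (fun n m => (∑ j, sinusoid θ₀ j n m) + w n m) (N l) (M l) (firstParams hkP.le θ₀)) :
    SameSinusoids θ' (firstParams hkP.le θ₀) := by
  classical
  have hθi : ∀ i, Tendsto (fun l => θ l i) F (𝓝 (θ' i)) := tendsto_pi_nhds.1 hθ
  -- the unexplained power is asymptotically at most that of the weak sinusoids
  set S := Finset.univ.filter (fun j : Fin P => k ≤ (j : ℕ)) with hS
  set A : ι → ℝ := fun l => rectAvg (N l) (M l) fun n m =>
    misfit θ₀ (θ l) n m * misfit θ₀ (θ l) n m with hA
  set A₀ : ι → ℝ := fun l => rectAvg (N l) (M l) fun n m =>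
    (∑ j ∈ S, wave (θ₀ j) n m) * ∑ j ∈ S, wave (θ₀ j) n m with hA₀
  have hA₀lim : Tendsto A₀ F (𝓝 (∑ j ∈ S, amp θ₀ j ^ 2 / 2)) := hfreq.tendsto_power hN hM S
  obtain ⟨δ, hδ, hAδ⟩ : ∃ δ : ι → ℝ, Tendsto δ F (𝓝 0) ∧ ∀ᶠ l in F, A l ≤ A₀ l + δ l := by
    have h1 := hw.tendsto_misfit (θ₀ := θ₀) hθ
    have h2 := hw.tendsto_misfit (θ₀ := θ₀) (F := F)
      (tendsto_const_nhds (x := firstParams hkP.le θ₀))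
    refine ⟨_, by simpa using (h2.const_mul 2).sub (h1.const_mul 2), ?_⟩
    filter_upwards [hloss] with l hl
    rw [loss_eq, loss_eq] at hl
    have : A₀ l = rectAvg (N l) (M l) fun n m => misfit θ₀ (firstParams hkP.le θ₀) n m *
        misfit θ₀ (firstParams hkP.le θ₀) n m := by
      simp only [hA₀, misfit_firstParams hkP.le, hS]
    rw [this]
    simp only [hA]
    linarith
  -- the true sinusoids whose frequency is a limit frequency are the dominant ones
  set T := Finset.univ.filter (fun j : Fin P => ∃ i, Aliased (θ' i) (θ₀ j)) with hT
  have hTcard : T.card ≤ k := by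
    have hex : ∀ j : T, ∃ i, Aliased (θ' i) (θ₀ j) := fun j => by
      simpa [hT] using (Finset.mem_filter.1 j.2).2
    choose f hf using hex
    have hinj : Function.Injective f := fun j j' hjj => Subtype.ext
      (hfreq.eq_of_aliased ((hf j).symm.trans (hjj ▸ hf j')))
    simpa using Fintype.card_le_of_injective f hinj
  have hTsum : ∑ j ∈ Tᶜ, amp θ₀ j ^ 2 ≤ ∑ j ∈ S, amp θ₀ j ^ 2 := by
    have h1 := hfreq.tendsto_power hN hM Tᶜ
    have h2 : Tendsto (fun l => rectAvg (N l) (M l) fun n m =>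
        (∑ j ∈ Tᶜ, wave (θ₀ j) n m) * ∑ j ∈ T, wave (θ₀ j) n m) F (𝓝 0) := by
      simp only [rectAvg_sum_mul_sum]
      rw [← Finset.sum_const_zero (s := Tᶜ)]
      refine tendsto_finsetSum _ fun j hj => ?_
      rw [← Finset.sum_const_zero (s := T)]
      refine tendsto_finsetSum _ fun j' hj' => ?_
      refine tendsto_rectAvg_wave_mul_wave hN hM (p := fun _ => θ₀ j) (q := fun _ => θ₀ j')
        tendsto_const_nhds tendsto_const_nhds (hfreq.inBox j) (hfreq.inBox j') fun hal => ?_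
      rw [hfreq.eq_of_aliased hal] at hj
      exact Finset.mem_compl.1 hj hj'
    have h3 : Tendsto (fun l => rectAvg (N l) (M l) fun n m =>
        (∑ j ∈ Tᶜ, wave (θ₀ j) n m) * ∑ i, wave (θ l i) n m) F (𝓝 0) := by
      simp only [rectAvg_sum_mul_sum]
      rw [← Finset.sum_const_zero (s := Tᶜ)]
      refine tendsto_finsetSum _ fun j hj => ?_
      rw [← Finset.sum_const_zero (s := (Finset.univ : Finset (Fin k)))]
      refine tendsto_finsetSum _ fun i _ => ?_
      refine tendsto_rectAvg_wave_mul_wave hN hM (p := fun _ => θ₀ j) (q := fun l => θ l i)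
        tendsto_const_nhds (hθi i) (hfreq.inBox j) (hbox i) fun hal => ?_
      exact Finset.mem_compl.1 hj (by simpa [hT] using ⟨i, hal.symm⟩)
    have h4 : ∀ l, rectAvg (N l) (M l) (fun n m =>
        (∑ j ∈ Tᶜ, wave (θ₀ j) n m) * ∑ j ∈ Tᶜ, wave (θ₀ j) n m) +
        2 * (rectAvg (N l) (M l) (fun n m =>
          (∑ j ∈ Tᶜ, wave (θ₀ j) n m) * ∑ j ∈ T, wave (θ₀ j) n m) -
        rectAvg (N l) (M l) (fun n m =>
          (∑ j ∈ Tᶜ, wave (θ₀ j) n m) * ∑ i, wave (θ l i) n m)) ≤ A l := by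
      intro l
      have h5 : 0 ≤ rectAvg (N l) (M l) (fun n m =>
          (∑ j ∈ T, wave (θ₀ j) n m - ∑ i, wave (θ l i) n m) *
            (∑ j ∈ T, wave (θ₀ j) n m - ∑ i, wave (θ l i) n m)) :=
        rectAvg_nonneg fun n m => mul_self_nonneg _
      refine (le_add_of_nonneg_right h5).trans (le_of_eq ?_)
      rw [← rectAvg_sub, ← rectAvg_const_mul, ← rectAvg_add, ← rectAvg_add]
      simp only [hA, misfit]
      congr 1
      funext n m
      rw [← Finset.sum_add_sum_compl T]
      ring
    have h6 := le_of_tendsto_of_tendsto (h1.add ((h2.sub h3).const_mul 2)) (hA₀lim.add hδ)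
      (hAδ.mono fun l hl => (h4 l).trans hl)
    simp only [sub_zero, mul_zero, add_zero, ← Finset.sum_div] at h6
    linarith
  have hTeq := eq_filter_of_sum_compl_le hkP hamp.antitone hamp.gap hamp.pos hTcard hTsum
  -- hence the limit frequencies are those of the dominant sinusoids, in some order
  have hex : ∀ i : Fin k, ∃ i', Aliased (θ' i') (firstParams hkP.le θ₀ i) := fun i => by
    have : Fin.castLE hkP.le i ∈ T := by
      rw [hTeq]; simp
    exact (Finset.mem_filter.1 this).2
  choose τ hτ using hex
  have hτinj : Function.Injective τ := fun i i' h => by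
    have := hfreq.eq_of_aliased ((hτ i).symm.trans (h ▸ hτ i'))
    exact Fin.castLE_injective hkP.le this
  set σ : Equiv.Perm (Fin k) := Equiv.ofBijective τ (Finite.injective_iff_bijective.1 hτinj)
    with hσ
  have hσal : ∀ i, Aliased (θ' (σ i)) (firstParams hkP.le θ₀ i) := hτ
  -- the errors made on the individual sinusoids are asymptotically orthogonal
  set e : ι → Fin k → ℕ → ℕ → ℝ := fun l i n m =>
    wave (firstParams hkP.le θ₀ i) n m - wave (θ l (σ i)) n m with he
  have hmis : ∀ l n m, misfit θ₀ (θ l) n m = ∑ j ∈ S, wave (θ₀ j) n m + ∑ i, e l i n m := by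
    intro l n m
    rw [← misfit_firstParams hkP.le]
    simp only [misfit, he, Finset.sum_sub_distrib]
    rw [Equiv.sum_comp σ fun i => wave (θ l i) n m]
    ring
  have hb₀ : ∀ i, InBox (firstParams hkP.le θ₀ i) := fun i => hfreq.inBox _
  have hne : ∀ i i', i ≠ i' →
      ¬ Aliased (firstParams hkP.le θ₀ i) (firstParams hkP.le θ₀ i') := fun i i' h hal =>
    h (Fin.castLE_injective hkP.le (hfreq.eq_of_aliased hal))
  have hcross : ∀ i i', i ≠ i' →
      Tendsto (fun l => rectAvg (N l) (M l) fun n m => e l i n m * e l i' n m) F (𝓝 0) := by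
    intro i i' hii
    have c1 := tendsto_rectAvg_wave_mul_wave hN hM (tendsto_const_nhds (f := F))
      (tendsto_const_nhds (f := F)) (hb₀ i) (hb₀ i') (hne i i' hii)
    have c2 := tendsto_rectAvg_wave_mul_wave hN hM (tendsto_const_nhds (f := F))
      (hθi (σ i')) (hb₀ i) (hbox _) (fun h => hne i i' hii (h.trans (hσal i')))
    have c3 := tendsto_rectAvg_wave_mul_wave hN hM (hθi (σ i)) (tendsto_const_nhds (f := F))
      (hbox _) (hb₀ i') (fun h => hne i i' hii ((hσal i).symm.trans h))
    have c4 := tendsto_rectAvg_wave_mul_wave hN hM (hθi (σ i)) (hθi (σ i')) (hbox _) (hbox _)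
      (fun h => hne i i' hii ((hσal i).symm.trans (h.trans (hσal i'))))
    have := ((c1.sub c2).sub c3).add c4
    simp only [sub_zero, add_zero] at this
    refine this.congr fun l => ?_
    rw [← rectAvg_sub, ← rectAvg_sub, ← rectAvg_add]
    congr 1
    funext n m
    simp only [he]
    ring
  have hcross' : Tendsto (fun l => rectAvg (N l) (M l) fun n m =>
      (∑ j ∈ S, wave (θ₀ j) n m) * ∑ i, e l i n m) F (𝓝 0) := by
    simp only [rectAvg_sum_mul_sum]
    rw [← Finset.sum_const_zero (s := S)]
    refine tendsto_finsetSum _ fun j hj => ?_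
    rw [← Finset.sum_const_zero (s := (Finset.univ : Finset (Fin k)))]
    refine tendsto_finsetSum _ fun i _ => ?_
    have hji : ¬ Aliased (θ₀ j) (firstParams hkP.le θ₀ i) := fun h => by
      have h1 : j = Fin.castLE hkP.le i := hfreq.eq_of_aliased h
      have h2 : k ≤ (j : ℕ) := (Finset.mem_filter.1 hj).2
      rw [h1, Fin.val_castLE] at h2
      exact absurd i.2 (not_lt.2 h2)
    have c1 := tendsto_rectAvg_wave_mul_wave hN hM (tendsto_const_nhds (f := F))
      (tendsto_const_nhds (f := F)) (hfreq.inBox j) (hb₀ i) hji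
    have c2 := tendsto_rectAvg_wave_mul_wave hN hM (tendsto_const_nhds (f := F))
      (hθi (σ i)) (hfreq.inBox j) (hbox _) (fun h => hji (h.trans (hσal i)))
    have := c1.sub c2
    rw [sub_zero] at this
    refine this.congr fun l => ?_
    rw [← rectAvg_sub]
    simp only [he, mul_sub]
  -- so each of them tends to zero in mean square
  have hsq : ∀ i, Tendsto (fun l => rectAvg (N l) (M l) fun n m => e l i n m * e l i n m) F
      (𝓝 0) := by
    intro i
    have hoff : Tendsto (fun l => ∑ i₁, ∑ i₂ ∈ Finset.univ.erase i₁,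
        rectAvg (N l) (M l) fun n m => e l i₁ n m * e l i₂ n m) F (𝓝 0) := by
      rw [← Finset.sum_const_zero (s := (Finset.univ : Finset (Fin k)))]
      refine tendsto_finsetSum _ fun i₁ _ => ?_
      rw [← Finset.sum_const_zero (s := Finset.univ.erase i₁)]
      exact tendsto_finsetSum _ fun i₂ h => hcross _ _ (Finset.ne_of_mem_erase h).symm
    have hub : Tendsto (fun l => δ l - 2 * (rectAvg (N l) (M l) fun n m =>
        (∑ j ∈ S, wave (θ₀ j) n m) * ∑ i, e l i n m) - ∑ i₁, ∑ i₂ ∈ Finset.univ.erase i₁,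
        rectAvg (N l) (M l) fun n m => e l i₁ n m * e l i₂ n m) F (𝓝 0) := by
      simpa using (hδ.sub (hcross'.const_mul 2)).sub hoff
    refine squeeze_zero' (Eventually.of_forall fun l => rectAvg_nonneg fun n m =>
      mul_self_nonneg _) ?_ hub
    filter_upwards [hAδ] with l hl
    have h1 : A l = A₀ l + 2 * (rectAvg (N l) (M l) fun n m =>
        (∑ j ∈ S, wave (θ₀ j) n m) * ∑ i, e l i n m) +
        rectAvg (N l) (M l) fun n m => (∑ i, e l i n m) * ∑ i, e l i n m := by
      rw [← rectAvg_const_mul, ← rectAvg_add, ← rectAvg_add]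
      simp only [hA, hmis]
      congr 1
      funext n m
      ring
    have h2 : (rectAvg (N l) (M l) fun n m => (∑ i, e l i n m) * ∑ i, e l i n m) =
        ∑ i₁, (rectAvg (N l) (M l) fun n m => e l i₁ n m * e l i₁ n m) +
          ∑ i₁, ∑ i₂ ∈ Finset.univ.erase i₁,
            rectAvg (N l) (M l) fun n m => e l i₁ n m * e l i₂ n m := by
      rw [rectAvg_sum_mul_sum, ← Finset.sum_add_distrib]
      exact Finset.sum_congr rfl fun i₁ _ =>
        (Finset.add_sum_erase _ _ (Finset.mem_univ i₁)).symm
    have h3 := Finset.single_le_sum (s := Finset.univ)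
      (f := fun i₁ => rectAvg (N l) (M l) fun n m => e l i₁ n m * e l i₁ n m)
      (fun i₁ _ => rectAvg_nonneg fun n m => mul_self_nonneg _) (Finset.mem_univ i)
    linarith
  refine ⟨σ, fun i n m => ?_⟩
  exact congrFun (congrFun (wave_eq_of_tendsto hN hM (hθi (σ i)) (hb₀ i)
    (hfreq.not_self _) (hσal i) (hamp.pos _) (hsq i)) n) m

end Consistency

/-- Deterministic consistency: if the noise is asymptotically orthogonal to all sinusoids, the
distance of the least squares estimates to the parameters of the dominant sinusoids tends to
zero. -/
theorem tendsto_infDist {k P : ℕ} (hkP : k < P) {θ₀ : Params P} (hfreq : DistinctFrequencies θ₀)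
    (hamp : DominantFirst k θ₀) {Θ : Set (Params k)} (hΘ : IsParameterSpace Θ)
    (hθ₀ : firstParams hkP.le θ₀ ∈ Θ) {N M : ℕ → ℕ} (hN : Tendsto N atTop atTop)
    (hM : Tendsto M atTop atTop) {w : ℕ → ℕ → ℝ} (hw : UniformlyOrthogonal atTop N M w)
    {θ : ℕ → Params k}
    (hθ : ∀ l, IsLeastSquaresEstimate Θ (fun n m => (∑ j, sinusoid θ₀ j n m) + w n m)
      (N l) (M l) (θ l)) :
    Tendsto (fun l => Metric.infDist (θ l) {θ ∈ Θ | SameSinusoids θ (firstParams hkP.le θ₀)})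
      atTop (𝓝 0) := by
  rw [tendsto_iff_ultrafilter]
  intro g hg
  obtain ⟨θ', hθ', hle⟩ := hΘ.compact.ultrafilter_le_nhds (g.map θ)
    (by rw [Ultrafilter.coe_map, le_principal_iff]; exact mem_map.2 (univ_mem' fun l => (hθ l).1))
  have hlim : Tendsto θ g (𝓝 θ') := hle
  have hsame : SameSinusoids θ' (firstParams hkP.le θ₀) :=
    sameSinusoids_of_tendsto (hN.mono_left hg) (hM.mono_left hg) hkP hfreq hamp
      (fun ε hε => hg (hw ε hε)) hlim (fun i => ⟨hΘ.freq₁_mem θ' hθ' i, hΘ.freq₂_mem θ' hθ' i⟩)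
      (Eventually.of_forall fun l => (hθ l).2 hθ₀)
  have := ((Metric.continuous_infDist_pt
    {θ ∈ Θ | SameSinusoids θ (firstParams hkP.le θ₀)}).tendsto θ').comp hlim
  rwa [Metric.infDist_zero_of_mem (show θ' ∈ {θ ∈ Θ | SameSinusoids θ (firstParams hkP.le θ₀)}
    from ⟨hθ', hsame⟩)] at this

/-! ### The periodogram of the driving field -/

/-- The unimodular character `q ↦ exp (i (α q₁ + β q₂))` of the lattice. -/
noncomputable def character (α β : ℝ) (q : ℤ × ℤ) : ℂ :=
  Complex.exp ((α * q.1 + β * q.2 : ℝ) * Complex.I)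

theorem norm_character (α β : ℝ) (q : ℤ × ℤ) : ‖character α β q‖ = 1 :=
  Complex.norm_exp_ofReal_mul_I _

theorem character_mul_conj (α β : ℝ) (q r : ℤ × ℤ) :
    character α β q * (starRingEnd ℂ) (character α β r) = character α β (q - r) := by
  rw [character, character, character, ← Complex.exp_conj, ← Complex.exp_add]
  congr 1
  simp only [map_mul, Complex.conj_ofReal, Complex.conj_I, Prod.fst_sub, Prod.snd_sub]
  push_cast
  ring

/-- The pairs of points of `R` with difference `h`. -/
def lagPairs (R : Finset (ℤ × ℤ)) (h : ℤ × ℤ) : Finset ((ℤ × ℤ) × (ℤ × ℤ)) :=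
  (R ×ˢ R).filter fun q => q.1 - q.2 = h

/-- The unnormalised empirical autocovariance of the field `x` over `R` at the lag `h`. -/
def lagSum (R : Finset (ℤ × ℤ)) (x : ℤ × ℤ → ℝ) (h : ℤ × ℤ) : ℝ :=
  ∑ q ∈ lagPairs R h, x q.1 * x q.2

/-- The differences of the points of `R`. -/
def lags (R : Finset (ℤ × ℤ)) : Finset (ℤ × ℤ) := (R ×ˢ R).image fun q => q.1 - q.2

/-- The sum of the moduli of the empirical autocovariances. -/
def lagBound (R : Finset (ℤ × ℤ)) (x : ℤ × ℤ → ℝ) : ℝ := ∑ h ∈ lags R, |lagSum R x h|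

/-- The periodogram is the Fourier series of the empirical autocovariances, so the sum of their
moduli bounds it at all frequencies at once. -/
theorem norm_sum_character_sq_le (R : Finset (ℤ × ℤ)) (x : ℤ × ℤ → ℝ) (α β : ℝ) :
    ‖∑ q ∈ R, (x q : ℂ) * character α β q‖ ^ 2 ≤ lagBound R x := by
  set S := ∑ q ∈ R, (x q : ℂ) * character α β q with hS
  have h1 : S * (starRingEnd ℂ) S = ∑ h ∈ lags R, (lagSum R x h : ℂ) * character α β h := by
    rw [hS, map_sum, Finset.sum_mul_sum, ← Finset.sum_product', ← Finset.sum_fiberwise_of_maps_to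
      (s := R ×ˢ R) (t := lags R) (g := fun q => q.1 - q.2)
      (fun q hq => Finset.mem_image_of_mem _ hq)]
    refine Finset.sum_congr rfl fun h _ => ?_
    rw [lagSum, Complex.ofReal_sum, Finset.sum_mul]
    refine Finset.sum_congr rfl fun q hq => ?_
    rw [← (Finset.mem_filter.1 hq).2, ← character_mul_conj]
    simp only [map_mul, Complex.conj_ofReal]
    push_cast
    ring
  have h2 : ‖S‖ ^ 2 = ‖S * (starRingEnd ℂ) S‖ := by
    rw [norm_mul, RCLike.norm_conj, sq]
  rw [h2, h1, lagBound]
  refine (norm_sum_le _ _).trans (Finset.sum_le_sum fun h _ => ?_)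
  rw [norm_mul, norm_character, mul_one, Complex.norm_real, Real.norm_eq_abs]

theorem lagBound_nonneg (R : Finset (ℤ × ℤ)) (x : ℤ × ℤ → ℝ) : 0 ≤ lagBound R x :=
  Finset.sum_nonneg fun _ _ => abs_nonneg _

theorem card_lagPairs_le (R : Finset (ℤ × ℤ)) (h : ℤ × ℤ) : (lagPairs R h).card ≤ R.card := by
  refine Finset.card_le_card_of_injOn Prod.fst
    (fun q hq => (Finset.mem_product.1 (Finset.mem_filter.1 hq).1).1) fun q hq r hr hqr => ?_
  have h1 := (Finset.mem_filter.1 hq).2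
  have h2 := (Finset.mem_filter.1 hr).2
  refine Prod.ext hqr (sub_right_injective (b := q.1) ?_)
  change q.1 - q.2 = q.1 - r.2
  rw [h1, hqr, h2]

/-- The rectangle `{0, …, N - 1} × {0, …, M - 1}` of the lattice `ℤ × ℤ`. -/
noncomputable def rect (N M : ℕ) : Finset (ℤ × ℤ) := Finset.Ico 0 (N : ℤ) ×ˢ Finset.Ico 0 (M : ℤ)

theorem card_rect (N M : ℕ) : (rect N M).card = N * M := by
  simp [rect]

theorem card_lags_rect_le (N M : ℕ) : (lags (rect N M)).card ≤ 4 * (N * M) := by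
  have : lags (rect N M) ⊆ Finset.Ico (-(N : ℤ)) N ×ˢ Finset.Ico (-(M : ℤ)) M := by
    intro h hh
    obtain ⟨q, hq, rfl⟩ := Finset.mem_image.1 hh
    simp only [rect, Finset.mem_product, Finset.mem_Ico, Prod.fst_sub, Prod.snd_sub] at hq ⊢
    omega
  refine (Finset.card_le_card this).trans (le_of_eq ?_)
  rw [Finset.card_product, Int.card_Ico, Int.card_Ico,
    show ((N : ℤ) - -N).toNat = 2 * N by omega, show ((M : ℤ) - -M).toNat = 2 * M by omega]
  ring

section Moments

variable {Ω : Type*} [MeasurableSpace Ω] {μ : Measure Ω}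
  {u : ℤ × ℤ → Ω → ℝ}

theorem DrivingField.shift (hu : DrivingField μ u) (p : ℤ × ℤ) :
    DrivingField μ fun q => u (q - p) where
  measurable q := hu.measurable _
  indep := hu.indep.precomp (g := fun q => q - p) sub_left_injective
  ident _ _ := hu.ident _ _
  finite_variance _ := hu.finite_variance _
  zero_mean _ := hu.zero_mean _
  moment := by
    obtain ⟨α, h1, h2⟩ := hu.moment
    exact ⟨α, h1, fun _ => h2 _⟩

theorem DrivingField.integral_sq_eq (hu : DrivingField μ u) (p : ℤ × ℤ) :
    ∫ x, u p x ^ 2 ∂μ = ∫ x, u 0 x ^ 2 ∂μ :=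
  ((hu.ident p 0).comp (measurable_id.pow_const 2)).integral_eq

/-- A product of four values of the driving field has mean zero if one of them has an index
different from those of the three others. -/
theorem DrivingField.integral_mul_eq_zero (hu : DrivingField μ u) {a b c d : ℤ × ℤ} (hb : a ≠ b)
    (hc : a ≠ c) (hd : a ≠ d) : ∫ x, u a x * (u b x * u c x * u d x) ∂μ = 0 := by
  have hdisj : Disjoint ({a} : Finset (ℤ × ℤ)) {b, c, d} := by
    simp [hb, hc, hd]
  have hind := hu.indep.indepFun_finset {a} {b, c, d} hdisj hu.measurable
  have h2 : IndepFun (u a) (fun x => u b x * u c x * u d x) μ :=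
    hind.comp (φ := fun f : ({a} : Finset (ℤ × ℤ)) → ℝ => f ⟨a, by simp⟩)
      (ψ := fun f : ({b, c, d} : Finset (ℤ × ℤ)) → ℝ =>
        f ⟨b, by simp⟩ * f ⟨c, by simp⟩ * f ⟨d, by simp⟩)
      (by fun_prop) (by fun_prop)
  rw [h2.integral_fun_mul_eq_mul_integral (hu.measurable a).aestronglyMeasurable
    ((((hu.measurable b).mul (hu.measurable c)).mul (hu.measurable d)).aestronglyMeasurable),
    hu.zero_mean, zero_mul]

theorem DrivingField.indepFun_sq (hu : DrivingField μ u) {a b : ℤ × ℤ} (hab : a ≠ b) :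
    IndepFun (fun x => u a x ^ 2) (fun x => u b x ^ 2) μ :=
  (hu.indep.indepFun hab).comp (φ := fun t : ℝ => t ^ 2) (ψ := fun t : ℝ => t ^ 2)
    (measurable_id.pow_const 2) (measurable_id.pow_const 2)

theorem DrivingField.memLp_mul (hu : DrivingField μ u) {a b : ℤ × ℤ} (hab : a ≠ b) :
    MemLp (fun x => u a x * u b x) 2 μ := by
  refine (memLp_two_iff_integrable_sq
    ((hu.measurable a).mul (hu.measurable b)).aestronglyMeasurable).2 ?_
  refine ((hu.indepFun_sq hab).integrable_mul (hu.finite_variance a).integrable_sq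
    (hu.finite_variance b).integrable_sq).congr (Eventually.of_forall fun x => ?_)
  simp only [Pi.mul_apply, mul_pow]

theorem DrivingField.integral_mul_sq (hu : DrivingField μ u) {a b : ℤ × ℤ} (hab : a ≠ b) :
    ∫ x, (u a x * u b x) * (u a x * u b x) ∂μ = (∫ x, u 0 x ^ 2 ∂μ) ^ 2 := by
  have := (hu.indepFun_sq hab).integral_fun_mul_eq_mul_integral
    ((hu.measurable a).pow_const 2).aestronglyMeasurable
    ((hu.measurable b).pow_const 2).aestronglyMeasurable
  rw [hu.integral_sq_eq a, hu.integral_sq_eq b, ← sq] at this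
  rw [← this]
  congr 1
  funext x
  ring

theorem DrivingField.integrable_mul (hu : DrivingField μ u) (a b : ℤ × ℤ) :
    Integrable (fun x => u a x * u b x) μ :=
  (hu.finite_variance a).integrable_mul (hu.finite_variance b)

theorem DrivingField.integrable_lagSum (hu : DrivingField μ u) (R : Finset (ℤ × ℤ))
    (h : ℤ × ℤ) : Integrable (fun x => lagSum R (fun q => u q x) h) μ :=
  integrable_finsetSum _ fun q _ => hu.integrable_mul q.1 q.2

theorem DrivingField.integral_abs_lagSum_zero_le (hu : DrivingField μ u)
    (R : Finset (ℤ × ℤ)) :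
    ∫ x, |lagSum R (fun q => u q x) 0| ∂μ ≤ R.card * ∫ x, u 0 x ^ 2 ∂μ := by
  have h1 : ∀ x, |lagSum R (fun q => u q x) 0| = ∑ q ∈ lagPairs R 0, u q.1 x ^ 2 := by
    intro x
    have : lagSum R (fun q => u q x) 0 = ∑ q ∈ lagPairs R 0, u q.1 x ^ 2 :=
      Finset.sum_congr rfl fun q hq => by
        rw [sub_eq_zero.1 (Finset.mem_filter.1 hq).2, sq]
    rw [this, abs_of_nonneg (Finset.sum_nonneg fun _ _ => sq_nonneg _)]
  simp only [h1]
  rw [integral_finsetSum _ fun q _ => (hu.finite_variance q.1).integrable_sq]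
  simp only [hu.integral_sq_eq, Finset.sum_const, nsmul_eq_mul]
  have := card_lagPairs_le R 0
  have : 0 ≤ ∫ x, u 0 x ^ 2 ∂μ := integral_nonneg fun x => sq_nonneg _
  gcongr

/-- At a lag `h ≠ 0` the products `u q * u (q - h)` are orthogonal, so the second moment of their
sum grows only like their number. -/
theorem DrivingField.integral_lagSum_sq_le (hu : DrivingField μ u) (R : Finset (ℤ × ℤ))
    {h : ℤ × ℤ} (hh : h ≠ 0) :
    Integrable (fun x => lagSum R (fun q => u q x) h ^ 2) μ ∧
    ∫ x, lagSum R (fun q => u q x) h ^ 2 ∂μ ≤ R.card * (∫ x, u 0 x ^ 2 ∂μ) ^ 2 := by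
  have hne : ∀ q ∈ lagPairs R h, q.1 ≠ q.2 := fun q hq heq =>
    hh (by rw [← (Finset.mem_filter.1 hq).2, heq, sub_self])
  have hexp : ∀ x, lagSum R (fun q => u q x) h ^ 2 = ∑ q ∈ lagPairs R h, ∑ r ∈ lagPairs R h,
      (u q.1 x * u q.2 x) * (u r.1 x * u r.2 x) := fun x => by
    rw [lagSum, sq, Finset.sum_mul_sum]
  have hint : ∀ q ∈ lagPairs R h, ∀ r ∈ lagPairs R h,
      Integrable (fun x => (u q.1 x * u q.2 x) * (u r.1 x * u r.2 x)) μ := fun q hq r hr =>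
    (hu.memLp_mul (hne q hq)).integrable_mul (hu.memLp_mul (hne r hr))
  have horth : ∀ q ∈ lagPairs R h, ∀ r ∈ lagPairs R h, q ≠ r →
      ∫ x, (u q.1 x * u q.2 x) * (u r.1 x * u r.2 x) ∂μ = 0 := by
    intro q hq r hr hqr
    have e1 : q.1 - q.2 = h := (Finset.mem_filter.1 hq).2
    have e2 : r.1 - r.2 = h := (Finset.mem_filter.1 hr).2
    have n1 : q.1 ≠ r.1 := fun e => hqr (Prod.ext e (by
      rw [← sub_sub_self q.1 q.2, e1, ← sub_sub_self r.1 r.2, e2, e]))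
    have n2 : q.2 ≠ r.2 := fun e => n1 (by rw [← sub_add_cancel q.1 q.2, e1, ← e2, e,
      sub_add_cancel])
    by_cases n3 : q.1 = r.2
    · -- then `q.2` differs from the three other indices
      have n4 : q.2 ≠ r.1 := by
        intro n4
        have h2 : h + h = 0 := by
          nth_rewrite 1 [← e1]
          rw [← e2, n3, n4]
          abel
        apply hh
        have a1 := congrArg Prod.fst h2
        have a2 := congrArg Prod.snd h2
        simp only [Prod.fst_add, Prod.snd_add, Prod.fst_zero, Prod.snd_zero] at a1 a2
        exact Prod.ext (by simp only [Prod.fst_zero]; omega) (by simp only [Prod.snd_zero]; omega)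
      rw [← hu.integral_mul_eq_zero (hne q hq).symm n4 n2]
      congr 1
      funext x
      ring
    · rw [← hu.integral_mul_eq_zero (hne q hq) n1 n3]
      congr 1
      funext x
      ring
  simp only [hexp]
  refine ⟨integrable_finsetSum _ fun q hq => integrable_finsetSum _ fun r hr => hint q hq r hr, ?_⟩
  rw [integral_finsetSum _ fun q hq => integrable_finsetSum _ fun r hr => hint q hq r hr]
  calc _ = ∑ q ∈ lagPairs R h, (∫ x, u 0 x ^ 2 ∂μ) ^ 2 := by
        refine Finset.sum_congr rfl fun q hq => ?_
        rw [integral_finsetSum _ fun r hr => hint q hq r hr, Finset.sum_eq_single q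
          (fun r hr hrq => horth q hq r hr hrq.symm) (fun hn => absurd hq hn),
          hu.integral_mul_sq (hne q hq)]
    _ = (lagPairs R h).card * (∫ x, u 0 x ^ 2 ∂μ) ^ 2 := by simp
    _ ≤ _ := by
      have := card_lagPairs_le R h
      gcongr

/-- The periodogram of the driving field over an `N × M` rectangle is at most of the order
`(N M) ^ (3 / 2)` in mean, uniformly over the frequencies. -/
theorem DrivingField.integral_lagBound_rect_le [IsProbabilityMeasure μ] (hu : DrivingField μ u)
    {N M : ℕ} {t : ℝ} (ht : 1 ≤ t) (hNM : (N : ℝ) * M = t ^ 2) :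
    ∫⁻ x, ENNReal.ofReal (lagBound (rect N M) fun q => u q x) ∂μ ≤
      ENNReal.ofReal ((2 + (∫ x, u 0 x ^ 2 ∂μ) + 2 * (∫ x, u 0 x ^ 2 ∂μ) ^ 2) * t ^ 3) := by
  set s := ∫ x, u 0 x ^ 2 ∂μ with hs
  have hs0 : 0 ≤ s := integral_nonneg fun x => sq_nonneg _
  set R := rect N M
  have hcard : (R.card : ℝ) = t ^ 2 := by rw [card_rect]; push_cast; exact hNM
  have hint : ∀ h, Integrable (fun x => |lagSum R (fun q => u q x) h|) μ := fun h =>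
    (hu.integrable_lagSum R h).abs
  have hz : ∫ x, |lagSum R (fun q => u q x) 0| ∂μ ≤ t ^ 2 * s := by
    rw [← hcard]; exact hu.integral_abs_lagSum_zero_le R
  have hnz : ∀ h ≠ 0, ∫ x, |lagSum R (fun q => u q x) h| ∂μ ≤ t * (1 + s ^ 2) / 2 := by
    intro h hh
    obtain ⟨i1, i2⟩ := hu.integral_lagSum_sq_le R hh
    rw [hcard, ← hs] at i2
    -- the arithmetic-geometric mean inequality with the weight `t = √(N M)`, the order of the sum
    have hle : ∀ x, |lagSum R (fun q => u q x) h| ≤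
        t / 2 + (1 / (2 * t)) * lagSum R (fun q => u q x) h ^ 2 := by
      intro x
      set y := lagSum R (fun q => u q x) h
      have : t / 2 + (1 / (2 * t)) * y ^ 2 - |y| = (t - |y|) ^ 2 / (2 * t) := by
        rw [← sq_abs y]; field_simp; ring
      have h0 : 0 ≤ (t - |y|) ^ 2 / (2 * t) := by positivity
      linarith
    calc ∫ x, |lagSum R (fun q => u q x) h| ∂μ
        ≤ ∫ x, (t / 2 + (1 / (2 * t)) * lagSum R (fun q => u q x) h ^ 2) ∂μ :=
          integral_mono (hint h) ((integrable_const _).add (i1.const_mul _)) hle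
      _ = t / 2 + (1 / (2 * t)) * ∫ x, lagSum R (fun q => u q x) h ^ 2 ∂μ := by
          rw [integral_add (integrable_const _) (i1.const_mul _), integral_const_mul]; simp
      _ ≤ t / 2 + (1 / (2 * t)) * (t ^ 2 * s ^ 2) := by gcongr
      _ = t * (1 + s ^ 2) / 2 := by field_simp
  have hintB : Integrable (fun x => lagBound R fun q => u q x) μ :=
    integrable_finsetSum _ fun h _ => hint h
  rw [← ofReal_integral_eq_lintegral_ofReal hintB
    (Eventually.of_forall fun x => lagBound_nonneg _ _)]
  refine ENNReal.ofReal_le_ofReal ?_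
  simp only [lagBound]
  rw [integral_finsetSum _ fun h _ => hint h]
  calc ∑ h ∈ lags R, ∫ x, |lagSum R (fun q => u q x) h| ∂μ
      ≤ ∑ h ∈ lags R, (t * (1 + s ^ 2) / 2 + if h = 0 then t ^ 2 * s else 0) := by
        refine Finset.sum_le_sum fun h _ => ?_
        split_ifs with h0
        · rw [h0]
          have : 0 ≤ t * (1 + s ^ 2) / 2 := by positivity
          linarith
        · rw [add_zero]; exact hnz h h0
    _ ≤ (4 * t ^ 2) * (t * (1 + s ^ 2) / 2) + t ^ 2 * s := by
        rw [Finset.sum_add_distrib, Finset.sum_const, nsmul_eq_mul]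
        have hl : ((lags R).card : ℝ) ≤ 4 * t ^ 2 := by
          rw [← hNM]; exact_mod_cast card_lags_rect_le N M
        gcongr
        rw [Finset.sum_ite_eq']
        split_ifs
        · exact le_rfl
        · positivity
    _ ≤ (2 + s + 2 * s ^ 2) * t ^ 3 := by
        have : t ^ 2 * s ≤ t ^ 3 * s := by gcongr; norm_num
        linarith

end Moments

/-! ### Bounds of the noise -/

/-- The Cauchy–Schwarz inequality for series with weights `b`. -/
theorem tsum_mul_sq_le {κ : Type*} (b c : κ → ℝ≥0∞) :
    (∑' i, b i * c i) ^ 2 ≤ (∑' i, b i) * ∑' i, b i * c i ^ 2 := by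
  have amgm : ∀ s t : ℝ≥0∞, 2 * (s * t) ≤ s ^ 2 + t ^ 2 := by
    intro s t
    induction s using ENNReal.recTopCoe with
    | top => simp
    | coe s =>
      induction t using ENNReal.recTopCoe with
      | top => simp
      | coe t =>
        rw [← mul_assoc]
        exact_mod_cast two_mul_le_add_sq s t
  have h1 : (∑' i, b i * c i) ^ 2 = ∑' i, ∑' j, (b i * c i) * (b j * c j) := by
    rw [sq, ← ENNReal.tsum_mul_right]
    exact tsum_congr fun i => ENNReal.tsum_mul_left.symm
  have h2 : (∑' i, b i) * ∑' i, b i * c i ^ 2 = ∑' i, ∑' j, b i * (b j * c j ^ 2) := by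
    rw [← ENNReal.tsum_mul_right]
    exact tsum_congr fun i => ENNReal.tsum_mul_left.symm
  have h3 : (∑' i, b i) * ∑' i, b i * c i ^ 2 = ∑' i, ∑' j, b i * (b j * c i ^ 2) := by
    rw [h2, ENNReal.tsum_comm]
    exact tsum_congr fun i => tsum_congr fun j => by ring
  refine (ENNReal.mul_le_mul_iff_right two_ne_zero ENNReal.ofNat_ne_top).1 ?_
  calc 2 * (∑' i, b i * c i) ^ 2
      = ∑' i, ∑' j, (b i * b j) * (2 * (c i * c j)) := by
        rw [h1, ← ENNReal.tsum_mul_left]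
        refine tsum_congr fun i => ?_
        rw [← ENNReal.tsum_mul_left]
        exact tsum_congr fun j => by ring
    _ ≤ ∑' i, ∑' j, (b i * b j) * (c i ^ 2 + c j ^ 2) :=
        ENNReal.tsum_le_tsum fun i => ENNReal.tsum_le_tsum fun j => by gcongr; exact amgm _ _
    _ = 2 * ((∑' i, b i) * ∑' i, b i * c i ^ 2) := by
        rw [two_mul]
        nth_rewrite 1 [h3]
        rw [h2, ← ENNReal.tsum_add]
        refine tsum_congr fun i => ?_
        rw [← ENNReal.tsum_add]
        exact tsum_congr fun j => by ring

theorem sum_sq_le_card_mul {κ : Type*} (s : Finset κ) (c : κ → ℝ≥0∞) :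
    (∑ i ∈ s, c i) ^ 2 ≤ s.card * ∑ i ∈ s, c i ^ 2 := by
  have := tsum_mul_sq_le (fun _ : s => 1) (fun i => c i)
  simp only [tsum_fintype, one_mul] at this
  rw [Finset.sum_coe_sort s c, Finset.sum_coe_sort s fun i => c i ^ 2] at this
  simpa using this

/-- A Borel–Cantelli argument: variables whose squares have bounds `X k` with summable normalised
means are almost surely of smaller order than the normalisation. -/
theorem ae_eventually_abs_le {Ω : Type*} [MeasurableSpace Ω] {μ : Measure Ω} {κ : Type*}
    [Countable κ] {X : κ → Ω → ℝ≥0∞} (hX : ∀ k, Measurable (X k)) {D c : κ → ℝ}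
    (hD : ∀ k, 0 < D k) (hc : Summable c) (hc0 : ∀ k, 0 ≤ c k)
    (h : ∀ k, ∫⁻ x, X k x ∂μ ≤ ENNReal.ofReal (D k ^ 2 * c k)) :
    ∀ᵐ x ∂μ, ∀ ε > 0, ∀ᶠ k in cofinite, ∀ y : ℝ, ENNReal.ofReal (y ^ 2) ≤ X k x →
      |y| ≤ ε * D k := by
  have hD2 : ∀ k, ENNReal.ofReal (D k ^ 2) ≠ 0 := fun k => by
    have := hD k
    simp only [ne_eq, ENNReal.ofReal_eq_zero, not_le]
    positivity
  have h1 : ∀ k, ∫⁻ x, (ENNReal.ofReal (D k ^ 2))⁻¹ * X k x ∂μ ≤ ENNReal.ofReal (c k) := by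
    intro k
    rw [lintegral_const_mul _ (hX k), ENNReal.inv_mul_le_iff (hD2 k) ENNReal.ofReal_ne_top,
      ← ENNReal.ofReal_mul (sq_nonneg _)]
    exact h k
  have hmeas : ∀ k, Measurable fun x => (ENNReal.ofReal (D k ^ 2))⁻¹ * X k x := fun k =>
    (hX k).const_mul _
  have h2 : ∫⁻ x, ∑' k, (ENNReal.ofReal (D k ^ 2))⁻¹ * X k x ∂μ ≠ ∞ := by
    rw [lintegral_tsum fun k => (hmeas k).aemeasurable]
    refine ne_top_of_le_ne_top ?_ (ENNReal.tsum_le_tsum h1)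
    rw [← ENNReal.ofReal_tsum_of_nonneg hc0 hc]
    exact ENNReal.ofReal_ne_top
  filter_upwards [ae_lt_top (Measurable.tsum hmeas) h2] with x hx ε hε
  have h3 := ENNReal.tendsto_cofinite_zero_of_tsum_ne_top hx.ne
  filter_upwards [h3.eventually (gt_mem_nhds (ENNReal.ofReal_pos.2 (pow_pos hε 2)))]
    with k hk y hy
  have h4 := (ENNReal.inv_mul_le_iff (hD2 k) ENNReal.ofReal_ne_top).1 hk.le
  rw [← ENNReal.ofReal_mul (sq_nonneg _)] at h4
  have h5 := (ENNReal.ofReal_le_ofReal_iff (by positivity)).1 (hy.trans h4)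
  refine abs_le_of_sq_le_sq (by linarith [mul_pow ε (D k) 2]) (mul_nonneg hε.le (hD k).le)

section Noise

variable {Ω : Type*} {u : ℤ × ℤ → Ω → ℝ} {a : ℤ × ℤ → ℝ}

theorem noise_apply (a : ℤ × ℤ → ℝ) (u : ℤ × ℤ → Ω → ℝ) (q : ℤ × ℤ) (x : Ω) :
    noise a u q.1 q.2 x = ∑' p : halfPlane, a p.1 * u (q - p.1) x := rfl

/-- The sum of the moduli of the moving average coefficients. -/
noncomputable def coeffSum (a : ℤ × ℤ → ℝ) : ℝ≥0∞ := ∑' p : halfPlane, ‖a p.1‖ₑ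

theorem AbsSummable.coeffSum_ne_top (ha : AbsSummable a) : coeffSum a ≠ ∞ :=
  tsum_enorm_ne_top_iff_summable_norm.2 ha

/-- A bound, uniform over the frequencies, of the periodogram of the noise over `R`. -/
noncomputable def noiseLagBound (a : ℤ × ℤ → ℝ) (u : ℤ × ℤ → Ω → ℝ) (R : Finset (ℤ × ℤ))
    (x : Ω) : ℝ≥0∞ :=
  coeffSum a * ∑' p : halfPlane, ‖a p.1‖ₑ * ENNReal.ofReal (lagBound R fun q => u (q - p.1) x)

/-- A bound of the square of the sum of the moduli of the noise over `R`. -/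
noncomputable def noiseAbsBound (a : ℤ × ℤ → ℝ) (u : ℤ × ℤ → Ω → ℝ) (R : Finset (ℤ × ℤ))
    (x : Ω) : ℝ≥0∞ :=
  R.card * ∑ q ∈ R, coeffSum a *
    ∑' p : halfPlane, ‖a p.1‖ₑ * ENNReal.ofReal (u (q - p.1) x ^ 2)

theorem enorm_sq_eq_ofReal (z : ℂ) : ‖z‖ₑ ^ 2 = ENNReal.ofReal (‖z‖ ^ 2) := by
  rw [← ofReal_norm, ENNReal.ofReal_pow (norm_nonneg _)]

/-- The Fourier sums of the noise are superpositions of those of the shifted driving field. -/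
theorem ofReal_norm_sum_noise_sq_le {x : Ω}
    (hx : ∀ q, Summable fun p : halfPlane => a p.1 * u (q - p.1) x) (R : Finset (ℤ × ℤ))
    (α β : ℝ) :
    ENNReal.ofReal (‖∑ q ∈ R, (noise a u q.1 q.2 x : ℂ) * character α β q‖ ^ 2) ≤
      noiseLagBound a u R x := by
  have h1 : ∑ q ∈ R, (noise a u q.1 q.2 x : ℂ) * character α β q =
      ∑' p : halfPlane, (a p.1 : ℂ) * ∑ q ∈ R, (u (q - p.1) x : ℂ) * character α β q := by
    have hs : ∀ q, Summable fun p : halfPlane =>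
        ((a p.1 * u (q - p.1) x : ℝ) : ℂ) * character α β q := fun q =>
      (Complex.summable_ofReal.2 (hx q)).mul_right _
    calc _ = ∑ q ∈ R, ∑' p : halfPlane,
          ((a p.1 * u (q - p.1) x : ℝ) : ℂ) * character α β q := by
          refine Finset.sum_congr rfl fun q _ => ?_
          rw [tsum_mul_right, noise_apply, Complex.ofReal_tsum]
      _ = _ := by
          rw [← Summable.tsum_finsetSum fun q _ => hs q]
          refine tsum_congr fun p => ?_
          rw [Finset.mul_sum]
          refine Finset.sum_congr rfl fun q _ => ?_
          push_cast
          ring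
  rw [← enorm_sq_eq_ofReal, h1, noiseLagBound, coeffSum]
  calc _ ≤ (∑' p : halfPlane, ‖a p.1‖ₑ *
        ‖∑ q ∈ R, (u (q - p.1) x : ℂ) * character α β q‖ₑ) ^ 2 := by
        gcongr
        refine enorm_tsum_le_tsum_enorm.trans (ENNReal.tsum_le_tsum fun p => ?_)
        rw [enorm_mul]
        gcongr
        rw [← ofReal_norm, ← ofReal_norm, Complex.norm_real]
    _ ≤ _ := tsum_mul_sq_le _ _
    _ ≤ _ := by
        gcongr with p
        rw [enorm_sq_eq_ofReal]
        exact ENNReal.ofReal_le_ofReal (norm_sum_character_sq_le R _ α β)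

theorem ofReal_sum_abs_noise_sq_le (R : Finset (ℤ × ℤ)) (x : Ω) :
    ENNReal.ofReal ((∑ q ∈ R, |noise a u q.1 q.2 x|) ^ 2) ≤ noiseAbsBound a u R x := by
  have h0 : ENNReal.ofReal ((∑ q ∈ R, |noise a u q.1 q.2 x|) ^ 2) =
      (∑ q ∈ R, ‖noise a u q.1 q.2 x‖ₑ) ^ 2 := by
    rw [ENNReal.ofReal_pow (Finset.sum_nonneg fun _ _ => abs_nonneg _),
      ENNReal.ofReal_sum_of_nonneg fun _ _ => abs_nonneg _]
    simp only [Real.enorm_eq_ofReal_abs]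
  rw [h0, noiseAbsBound]
  refine (sum_sq_le_card_mul _ _).trans ?_
  gcongr with q
  calc _ ≤ (∑' p : halfPlane, ‖a p.1‖ₑ * ‖u (q - p.1) x‖ₑ) ^ 2 := by
        gcongr
        rw [noise_apply]
        refine enorm_tsum_le_tsum_enorm.trans (ENNReal.tsum_le_tsum fun p => ?_)
        rw [enorm_mul]
    _ ≤ _ := tsum_mul_sq_le _ _
    _ = _ := by
        rw [coeffSum]
        simp only [Real.enorm_eq_ofReal_abs, ← ENNReal.ofReal_pow (abs_nonneg _), sq_abs]

variable [MeasurableSpace Ω] {μ : Measure Ω}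

theorem DrivingField.measurable_lagBound (hu : DrivingField μ u) (R : Finset (ℤ × ℤ)) :
    Measurable fun x => lagBound R fun q => u q x := by
  have := hu.measurable
  unfold lagBound lagSum
  fun_prop

theorem DrivingField.measurable_noiseLagBound (hu : DrivingField μ u) (R : Finset (ℤ × ℤ)) :
    Measurable (noiseLagBound a u R) := by
  have hm : ∀ p : halfPlane, Measurable fun x =>
      ENNReal.ofReal (lagBound R fun q => u (q - p.1) x) := fun p =>
    ((hu.shift p.1).measurable_lagBound R).ennreal_ofReal
  unfold noiseLagBound
  exact (Measurable.tsum fun p => (hm p).const_mul _).const_mul _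

theorem DrivingField.measurable_noiseAbsBound (hu : DrivingField μ u) (R : Finset (ℤ × ℤ)) :
    Measurable (noiseAbsBound a u R) :=
  (Finset.measurable_fun_sum _ fun _ _ => (Measurable.tsum fun _ =>
    (((hu.measurable _).pow_const 2).ennreal_ofReal).const_mul _).const_mul _).const_mul _

theorem DrivingField.lintegral_noiseLagBound_le [IsProbabilityMeasure μ] (hu : DrivingField μ u)
    (ha : AbsSummable a) {N M : ℕ} {t : ℝ} (ht : 1 ≤ t) (hNM : (N : ℝ) * M = t ^ 2) :
    ∫⁻ x, noiseLagBound a u (rect N M) x ∂μ ≤ ENNReal.ofReal ((coeffSum a).toReal ^ 2 *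
      ((2 + (∫ x, u 0 x ^ 2 ∂μ) + 2 * (∫ x, u 0 x ^ 2 ∂μ) ^ 2) * t ^ 3)) := by
  have hm : ∀ p : halfPlane, Measurable fun x =>
      ENNReal.ofReal (lagBound (rect N M) fun q => u (q - p.1) x) := fun p =>
    ((hu.shift p.1).measurable_lagBound _).ennreal_ofReal
  unfold noiseLagBound
  rw [lintegral_const_mul _ (Measurable.tsum fun p => (hm p).const_mul _),
    lintegral_tsum fun p => ((hm p).const_mul _).aemeasurable]
  calc _ ≤ coeffSum a * ∑' p : halfPlane, ‖a p.1‖ₑ * ENNReal.ofReal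
        ((2 + (∫ x, u 0 x ^ 2 ∂μ) + 2 * (∫ x, u 0 x ^ 2 ∂μ) ^ 2) * t ^ 3) := by
        gcongr with p
        rw [lintegral_const_mul _ (hm p)]
        gcongr
        have := (hu.shift p.1).integral_lagBound_rect_le ht hNM
        rwa [hu.integral_sq_eq] at this
    _ = _ := by
        rw [ENNReal.tsum_mul_right, ← coeffSum,
          ENNReal.ofReal_mul (p := (coeffSum a).toReal ^ 2) (by positivity),
          ENNReal.ofReal_pow ENNReal.toReal_nonneg, ENNReal.ofReal_toReal ha.coeffSum_ne_top,
          sq (coeffSum a), mul_assoc]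

theorem DrivingField.lintegral_sq (hu : DrivingField μ u) (q : ℤ × ℤ) :
    ∫⁻ x, ENNReal.ofReal (u q x ^ 2) ∂μ = ENNReal.ofReal (∫ x, u 0 x ^ 2 ∂μ) := by
  rw [← hu.integral_sq_eq q, ofReal_integral_eq_lintegral_ofReal
    (hu.finite_variance q).integrable_sq (Eventually.of_forall fun x => sq_nonneg _)]

theorem DrivingField.lintegral_noiseAbsBound (hu : DrivingField μ u) (ha : AbsSummable a)
    (R : Finset (ℤ × ℤ)) :
    ∫⁻ x, noiseAbsBound a u R x ∂μ = ENNReal.ofReal ((R.card : ℝ) ^ 2 *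
      ((coeffSum a).toReal ^ 2 * ∫ x, u 0 x ^ 2 ∂μ)) := by
  have hm : ∀ (q : ℤ × ℤ) (p : halfPlane), Measurable fun x =>
      ENNReal.ofReal (u (q - p.1) x ^ 2) := fun q p =>
    ((hu.measurable _).pow_const 2).ennreal_ofReal
  have hm' : ∀ q : ℤ × ℤ, Measurable fun x => coeffSum a *
      ∑' p : halfPlane, ‖a p.1‖ₑ * ENNReal.ofReal (u (q - p.1) x ^ 2) := fun q =>
    (Measurable.tsum fun p => (hm q p).const_mul _).const_mul _
  have h1 : ∀ q : ℤ × ℤ, ∫⁻ x, coeffSum a *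
      ∑' p : halfPlane, ‖a p.1‖ₑ * ENNReal.ofReal (u (q - p.1) x ^ 2) ∂μ =
        coeffSum a * (coeffSum a * ENNReal.ofReal (∫ x, u 0 x ^ 2 ∂μ)) := by
    intro q
    rw [lintegral_const_mul _ (Measurable.tsum fun p => (hm q p).const_mul _),
      lintegral_tsum fun p => ((hm q p).const_mul _).aemeasurable]
    simp only [lintegral_const_mul _ (hm q _), hu.lintegral_sq, ENNReal.tsum_mul_right, coeffSum]
  unfold noiseAbsBound
  rw [lintegral_const_mul _ (Finset.measurable_fun_sum _ fun q _ => hm' q),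
    lintegral_finsetSum _ fun q _ => hm' q]
  simp only [h1, Finset.sum_const, nsmul_eq_mul]
  rw [ENNReal.ofReal_mul (by positivity), ENNReal.ofReal_mul (by positivity),
    ENNReal.ofReal_pow (by positivity), ENNReal.ofReal_pow ENNReal.toReal_nonneg,
    ENNReal.ofReal_toReal ha.coeffSum_ne_top, ENNReal.ofReal_natCast]
  ring

/-- The series that defines the noise converges almost surely at all points. -/
theorem DrivingField.ae_summable [IsProbabilityMeasure μ] (hu : DrivingField μ u)
    (ha : AbsSummable a) :
    ∀ᵐ x ∂μ, ∀ q, Summable fun p : halfPlane => a p.1 * u (q - p.1) x := by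
  rw [ae_all_iff]
  intro q
  have hn : ∑' p : halfPlane, eLpNorm (a p.1 • u (q - p.1)) 2 μ ≠ ∞ := by
    have : ∀ p : halfPlane, eLpNorm (a p.1 • u (q - p.1)) 2 μ =
        ‖a p.1‖ₑ * eLpNorm (u 0) 2 μ := fun p => by
      rw [eLpNorm_const_smul, (hu.ident (q - p.1) 0).eLpNorm_eq]
    simp only [this, ENNReal.tsum_mul_right]
    exact ENNReal.mul_ne_top ha.coeffSum_ne_top (hu.finite_variance 0).eLpNorm_ne_top
  have hm : ∀ p : halfPlane, AEStronglyMeasurable (a p.1 • u (q - p.1)) μ := fun p =>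
    ((hu.measurable (q - p.1)).const_smul (a p.1)).aestronglyMeasurable
  filter_upwards [summable_norm_of_tsum_eLpNorm_ne_top one_le_two hm hn] with x hx
  exact hx.of_norm

end Noise

/-! ### Almost sure orthogonality of the noise to all sinusoids -/

theorem sum_rect {E : Type*} [AddCommMonoid E] (N M : ℕ) (f : ℤ × ℤ → E) :
    ∑ q ∈ rect N M, f q = ∑ n ∈ Finset.range N, ∑ m ∈ Finset.range M, f ((n : ℤ), (m : ℤ)) := by
  have h : ∀ (K : ℕ) (g : ℤ → E), ∑ z ∈ Finset.Ico 0 (K : ℤ), g z =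
      ∑ n ∈ Finset.range K, g n := fun K g => by
    refine (Finset.sum_nbij (fun n : ℕ => (n : ℤ)) (fun n hn => ?_)
      (fun _ _ _ _ e => by simpa using e) (fun z hz => ?_) fun _ _ => rfl).symm
    · simpa using hn
    · have hz' : 0 ≤ z ∧ z < K := by simpa using hz
      exact ⟨z.toNat, by simp; omega, by simp; omega⟩
  rw [rect, Finset.sum_product, h]
  exact Finset.sum_congr rfl fun n _ => h M _

/-- The correlation of a field with a sinusoid is bounded by the modulus of its Fourier sum. -/
theorem abs_rectAvg_mul_cos_le (w : ℤ × ℤ → ℝ) (N M : ℕ) (α β φ : ℝ) :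
    |rectAvg N M fun n m => w (n, m) * Real.cos (α * n + β * m + φ)| ≤
      1 / ((N : ℝ) * M) * ‖∑ q ∈ rect N M, (w q : ℂ) * character α β q‖ := by
  have h : (∑ n ∈ Finset.range N, ∑ m ∈ Finset.range M,
      w (n, m) * Real.cos (α * n + β * m + φ)) =
      (Complex.exp (φ * Complex.I) * ∑ q ∈ rect N M, (w q : ℂ) * character α β q).re := by
    rw [sum_rect, Finset.mul_sum, Complex.re_sum]
    refine Finset.sum_congr rfl fun n _ => ?_
    rw [Finset.mul_sum, Complex.re_sum]
    refine Finset.sum_congr rfl fun m _ => ?_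
    rw [character, mul_left_comm, ← Complex.exp_add, Complex.re_ofReal_mul,
      ← Complex.exp_ofReal_mul_I_re]
    congr 3
    push_cast
    ring
  rw [rectAvg, h, abs_mul, abs_of_nonneg (by positivity)]
  gcongr
  refine (Complex.abs_re_le_norm _).trans (le_of_eq ?_)
  rw [norm_mul, Complex.norm_exp_ofReal_mul_I, one_mul]

/-- Every positive integer lies between consecutive fourth powers, whose bases tend to infinity. -/
theorem exists_fourth_root {N : ℕ → ℕ} (hN : Tendsto N atTop atTop) :
    ∃ J : ℕ → ℕ, Tendsto J atTop atTop ∧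
      ∀ᶠ l in atTop, (J l + 1) ^ 4 ≤ N l ∧ N l < (J l + 2) ^ 4 := by
  have key : ∀ n : ℕ, (n.sqrt.sqrt) ^ 4 ≤ n ∧ n < (n.sqrt.sqrt + 1) ^ 4 := by
    intro n
    have h1 := Nat.sqrt_le' n
    have h2 := Nat.lt_succ_sqrt' n
    have h3 := Nat.sqrt_le' n.sqrt
    have h4 := Nat.lt_succ_sqrt' n.sqrt
    constructor
    · calc (n.sqrt.sqrt) ^ 4 = (n.sqrt.sqrt ^ 2) ^ 2 := by ring
        _ ≤ n.sqrt ^ 2 := Nat.pow_le_pow_left h3 2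
        _ ≤ n := h1
    · calc n < (n.sqrt + 1) ^ 2 := h2
        _ ≤ ((n.sqrt.sqrt + 1) ^ 2) ^ 2 := Nat.pow_le_pow_left h4 2
        _ = _ := by ring
  have hr : Tendsto (fun l => (N l).sqrt.sqrt) atTop atTop := by
    refine tendsto_atTop.2 fun b => ?_
    filter_upwards [hN.eventually_ge_atTop (b ^ 4)] with l hl
    by_contra hlt
    have h1 := (key (N l)).2
    have h2 : ((N l).sqrt.sqrt + 1) ^ 4 ≤ b ^ 4 := Nat.pow_le_pow_left (by omega) 4
    omega
  refine ⟨fun l => (N l).sqrt.sqrt - 1, (tendsto_sub_atTop_nat 1).comp hr, ?_⟩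
  filter_upwards [hr.eventually_ge_atTop 1] with l hl
  have h1 := key (N l)
  rwa [show (N l).sqrt.sqrt - 1 + 1 = (N l).sqrt.sqrt by omega,
    show (N l).sqrt.sqrt - 1 + 2 = (N l).sqrt.sqrt + 1 by omega]

/-- The integers from `(j + 1) ^ 4` up to, but not including, `(j + 2) ^ 4`. -/
noncomputable def shell (j : ℕ) : Finset ℤ := Finset.Ico (((j + 1) ^ 4 : ℕ) : ℤ) ((j + 2) ^ 4 : ℕ)

/-- The strip of the lattice over `shell j`, of a height proportional to its distance from the
origin. -/
noncomputable def strip₁ (K j : ℕ) : Finset (ℤ × ℤ) :=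
  shell j ×ˢ Finset.Ico 0 ((K * (j + 2) ^ 4 : ℕ) : ℤ)

/-- The transpose of `strip₁`. -/
noncomputable def strip₂ (K j : ℕ) : Finset (ℤ × ℤ) :=
  Finset.Ico 0 ((K * (j + 2) ^ 4 : ℕ) : ℤ) ×ˢ shell j

/-- The strips have at most of the order of `(j + 1) ^ 7` points, which is thin compared with the
`(j + 1) ^ 8` points of the square of side `(j + 1) ^ 4`. -/
theorem card_shell_mul_le (K j : ℕ) :
    (shell j).card * (K * (j + 2) ^ 4) ≤ 240 * K * (j + 1) ^ 7 := by
  have h1 : (shell j).card ≤ 15 * (j + 1) ^ 3 := by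
    rw [shell, Int.card_Ico]
    have : (j + 2) ^ 4 ≤ (j + 1) ^ 4 + 15 * (j + 1) ^ 3 := by
      nlinarith [Nat.zero_le (j ^ 3), Nat.zero_le (j ^ 2)]
    generalize (j + 2) ^ 4 = x, (j + 1) ^ 4 = y, (j + 1) ^ 3 = z at *
    omega
  have h2 : (j + 2) ^ 4 ≤ 16 * (j + 1) ^ 4 := by
    calc (j + 2) ^ 4 ≤ (2 * (j + 1)) ^ 4 := Nat.pow_le_pow_left (by omega) 4
      _ = _ := by ring
  calc (shell j).card * (K * (j + 2) ^ 4) ≤ (15 * (j + 1) ^ 3) * (K * (16 * (j + 1) ^ 4)) := by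
        gcongr
    _ = _ := by ring

theorem card_strip₁_le (K j : ℕ) : (strip₁ K j).card ≤ 240 * K * (j + 1) ^ 7 := by
  rw [strip₁, Finset.card_product, Int.card_Ico, sub_zero, Int.toNat_natCast]
  exact card_shell_mul_le K j

theorem card_strip₂_le (K j : ℕ) : (strip₂ K j).card ≤ 240 * K * (j + 1) ^ 7 := by
  rw [strip₂, Finset.card_product, Int.card_Ico, sub_zero, Int.toNat_natCast, mul_comm]
  exact card_shell_mul_le K j

/-- A rectangle of bounded eccentricity differs from the largest rectangle inside it whose sides
are fourth powers by parts of two strips. -/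
theorem rect_sdiff_subset {K N M j i : ℕ} (hNK : N ≤ K * M) (hMK : M ≤ K * N)
    (hN : N < (j + 2) ^ 4) (hM : M < (i + 2) ^ 4) :
    rect N M \ rect ((j + 1) ^ 4) ((i + 1) ^ 4) ⊆ strip₁ K j ∪ strip₂ K i := by
  have h1 : M ≤ K * (j + 2) ^ 4 := hMK.trans (Nat.mul_le_mul_left K hN.le)
  have h2 : N ≤ K * (i + 2) ^ 4 := hNK.trans (Nat.mul_le_mul_left K hM.le)
  intro q hq
  simp only [rect, strip₁, strip₂, shell, Finset.mem_sdiff, Finset.mem_product, Finset.mem_Ico,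
    Finset.mem_union] at hq ⊢
  zify at h1 h2 hN hM
  push_cast at hq ⊢
  by_cases h : ((j : ℤ) + 1) ^ 4 ≤ q.1
  · left; omega
  · right; omega

theorem norm_sum_rect_le {w : ℤ × ℤ → ℝ} {K N M j i : ℕ} (hNK : N ≤ K * M) (hMK : M ≤ K * N)
    (hN : N < (j + 2) ^ 4) (hM : M < (i + 2) ^ 4) (hN' : (j + 1) ^ 4 ≤ N)
    (hM' : (i + 1) ^ 4 ≤ M) (α β : ℝ) :
    ‖∑ q ∈ rect N M, (w q : ℂ) * character α β q‖ ≤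
      ‖∑ q ∈ rect ((j + 1) ^ 4) ((i + 1) ^ 4), (w q : ℂ) * character α β q‖ +
        (∑ q ∈ strip₁ K j, |w q| + ∑ q ∈ strip₂ K i, |w q|) := by
  have hsub : rect ((j + 1) ^ 4) ((i + 1) ^ 4) ⊆ rect N M :=
    Finset.product_subset_product (Finset.Ico_subset_Ico_right (by exact_mod_cast hN'))
      (Finset.Ico_subset_Ico_right (by exact_mod_cast hM'))
  rw [← Finset.sum_sdiff hsub, add_comm]
  refine (norm_add_le _ _).trans ?_
  gcongr
  calc _ ≤ ∑ q ∈ rect N M \ rect ((j + 1) ^ 4) ((i + 1) ^ 4), |w q| := by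
        refine (norm_sum_le _ _).trans (le_of_eq (Finset.sum_congr rfl fun q _ => ?_))
        rw [norm_mul, norm_character, mul_one, Complex.norm_real, Real.norm_eq_abs]
    _ ≤ ∑ q ∈ strip₁ K j ∪ strip₂ K i, |w q| :=
        Finset.sum_le_sum_of_subset_of_nonneg (rect_sdiff_subset hNK hMK hN hM)
          fun _ _ _ => abs_nonneg _
    _ ≤ _ := by
        rw [← Finset.sum_union_inter]
        exact le_add_of_nonneg_right (Finset.sum_nonneg fun _ _ => abs_nonneg _)

section AlmostSure

variable {Ω : Type*} [MeasurableSpace Ω] {μ : Measure Ω}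
  {u : ℤ × ℤ → Ω → ℝ} {a : ℤ × ℤ → ℝ}

theorem summable_one_div_succ_sq : Summable fun j : ℕ => 1 / ((j : ℝ) + 1) ^ 2 := by
  simpa using (summable_nat_add_iff 1).2 (Real.summable_one_div_nat_pow.2 one_lt_two)

/-- On rectangles whose sides are fourth powers, the Fourier sums of the noise are almost surely of
smaller order than the number of points, uniformly over the frequencies: for sides `j ^ 4` and
`i ^ 4` the bound of the normalised second moment is of order `1 / (i j) ^ 2`, a summable array. -/
theorem DrivingField.ae_fourier_grid [IsProbabilityMeasure μ] (hu : DrivingField μ u)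
    (ha : AbsSummable a) :
    ∀ᵐ x ∂μ, ∀ ε > 0, ∀ᶠ k : ℕ × ℕ in cofinite, ∀ α β : ℝ,
      ‖∑ q ∈ rect ((k.1 + 1) ^ 4) ((k.2 + 1) ^ 4), (noise a u q.1 q.2 x : ℂ) * character α β q‖ ≤
        ε * (((k.1 : ℝ) + 1) ^ 4 * ((k.2 : ℝ) + 1) ^ 4) := by
  set C := (coeffSum a).toReal ^ 2 *
    (2 + (∫ x, u 0 x ^ 2 ∂μ) + 2 * (∫ x, u 0 x ^ 2 ∂μ) ^ 2) with hC
  have hC0 : 0 ≤ C := by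
    have : 0 ≤ ∫ x, u 0 x ^ 2 ∂μ := integral_nonneg fun x => sq_nonneg _
    positivity
  have hsum : Summable fun k : ℕ × ℕ =>
      C * (1 / ((k.1 : ℝ) + 1) ^ 2 * (1 / ((k.2 : ℝ) + 1) ^ 2)) :=
    (summable_one_div_succ_sq.mul_of_nonneg summable_one_div_succ_sq
      (fun _ => by positivity) fun _ => by positivity).mul_left C
  have hmain := ae_eventually_abs_le (μ := μ)
    (X := fun k : ℕ × ℕ => noiseLagBound a u (rect ((k.1 + 1) ^ 4) ((k.2 + 1) ^ 4)))
    (fun k => hu.measurable_noiseLagBound _)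
    (D := fun k : ℕ × ℕ => ((k.1 : ℝ) + 1) ^ 4 * ((k.2 : ℝ) + 1) ^ 4) (fun k => by positivity)
    hsum (fun k => by positivity) (fun k => by
      have ht : 1 ≤ (((k.1 : ℝ) + 1) * ((k.2 : ℝ) + 1)) ^ 2 :=
        one_le_pow₀ (one_le_mul_of_one_le_of_one_le (by simp) (by simp))
      refine (hu.lintegral_noiseLagBound_le ha ht (by push_cast; ring)).trans
        (le_of_eq (congrArg _ ?_))
      rw [← mul_assoc, ← hC]
      field_simp)
  filter_upwards [hmain, hu.ae_summable ha] with x hx hs ε hε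
  filter_upwards [hx ε hε] with k hk α β
  exact (le_abs_self _).trans (hk _ (ofReal_norm_sum_noise_sq_le hs _ α β))

/-- The sums of the moduli of the noise over sets of at most `C (j + 1) ^ 7` points are almost
surely of smaller order than `(j + 1) ^ 8`: their normalised second moments are of order
`1 / (j + 1) ^ 2`. -/
theorem DrivingField.ae_sum_abs_noise (hu : DrivingField μ u) (ha : AbsSummable a)
    (B : ℕ → Finset (ℤ × ℤ)) (C : ℕ) (hB : ∀ j, (B j).card ≤ C * (j + 1) ^ 7) :
    ∀ᵐ x ∂μ, ∀ ε > 0, ∀ᶠ j : ℕ in atTop,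
      ∑ q ∈ B j, |noise a u q.1 q.2 x| ≤ ε * ((j : ℝ) + 1) ^ 8 := by
  set c := (coeffSum a).toReal ^ 2 * ∫ x, u 0 x ^ 2 ∂μ with hc
  have hc0 : 0 ≤ c := by
    have : 0 ≤ ∫ x, u 0 x ^ 2 ∂μ := integral_nonneg fun x => sq_nonneg _
    positivity
  have hmain := ae_eventually_abs_le (μ := μ) (X := fun j => noiseAbsBound a u (B j))
    (fun j => hu.measurable_noiseAbsBound _) (D := fun j : ℕ => ((j : ℝ) + 1) ^ 8)
    (fun j => by positivity) (summable_one_div_succ_sq.mul_left ((C : ℝ) ^ 2 * c))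
    (fun j => by positivity) (fun j => by
      rw [hu.lintegral_noiseAbsBound ha, ← hc]
      refine ENNReal.ofReal_le_ofReal ?_
      have hBj : ((B j).card : ℝ) ≤ C * ((j : ℝ) + 1) ^ 7 := by exact_mod_cast hB j
      calc ((B j).card : ℝ) ^ 2 * c ≤ (C * ((j : ℝ) + 1) ^ 7) ^ 2 * c := by gcongr
        _ = _ := by field_simp)
  filter_upwards [hmain] with x hx ε hε
  rw [← Nat.cofinite_eq_atTop]
  filter_upwards [hx ε hε] with j hj
  exact (le_abs_self _).trans (hj _ (ofReal_sum_abs_noise_sq_le _ _))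

/-- The noise is almost surely asymptotically orthogonal to all sinusoids, uniformly. -/
theorem DrivingField.ae_uniformlyOrthogonal [IsProbabilityMeasure μ] (hu : DrivingField μ u)
    (ha : AbsSummable a)
    {N M : ℕ → ℕ} (hNM : RectanglesTendToInfinity N M) :
    ∀ᵐ x ∂μ, UniformlyOrthogonal atTop N M fun n m => noise a u n m x := by
  have hN : Tendsto N atTop atTop :=
    tendsto_atTop_mono (fun l => min_le_left _ _) hNM.min_tendsto
  have hM : Tendsto M atTop atTop :=
    tendsto_atTop_mono (fun l => min_le_right _ _) hNM.min_tendsto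
  obtain ⟨c, hc, hlim⟩ := hNM.ratio_tendsto
  obtain ⟨K, hK⟩ := exists_nat_ge (max (c + 1) (2 / c))
  -- the rectangles have eccentricity at most `K`
  have hNK : ∀ᶠ l in atTop, N l ≤ K * M l := by
    filter_upwards [hlim.eventually (gt_mem_nhds (lt_add_one c)), hM.eventually_gt_atTop 0]
      with l h1 h2
    have h2' : (0 : ℝ) < M l := by exact_mod_cast h2
    rw [div_lt_iff₀ h2'] at h1
    have : (N l : ℝ) ≤ K * M l :=
      h1.le.trans (mul_le_mul_of_nonneg_right ((le_max_left _ _).trans hK) h2'.le)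
    exact_mod_cast this
  have hMK : ∀ᶠ l in atTop, M l ≤ K * N l := by
    filter_upwards [hlim.eventually (lt_mem_nhds (half_lt_self hc)), hM.eventually_gt_atTop 0]
      with l h1 h2
    have h2' : (0 : ℝ) < M l := by exact_mod_cast h2
    rw [lt_div_iff₀ h2'] at h1
    have : (M l : ℝ) ≤ K * N l := by
      calc (M l : ℝ) = 2 / c * (c / 2 * M l) := by field_simp
        _ ≤ K * N l := by
          gcongr
          exact (le_max_right _ _).trans hK
    exact_mod_cast this
  obtain ⟨J, hJ, hJN⟩ := exists_fourth_root hN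
  obtain ⟨I, hI, hIM⟩ := exists_fourth_root hM
  have hJI : Tendsto (fun l => (J l, I l)) atTop cofinite := by
    refine le_cofinite_iff_eventually_ne.2 fun k => ?_
    rw [eventually_map]
    filter_upwards [hJ.eventually_gt_atTop k.1] with l hl h
    rw [← h] at hl
    exact lt_irrefl _ hl
  filter_upwards [hu.ae_fourier_grid ha,
    hu.ae_sum_abs_noise ha (strip₁ K) (240 * K) (card_strip₁_le K),
    hu.ae_sum_abs_noise ha (strip₂ K) (240 * K) (card_strip₂_le K)] with x h1 h2 h3 ε hε
  -- an error of `δ` on the grid rectangle, and of `K δ` on each of the two strips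
  set δ := ε / (1 + 2 * K) with hδ
  have hδ0 : 0 < δ := by positivity
  filter_upwards [hNK, hMK, hJN, hIM, hJI.eventually (h1 δ hδ0), hJ.eventually (h2 δ hδ0),
    hI.eventually (h3 δ hδ0), hN.eventually_gt_atTop 0, hM.eventually_gt_atTop 0]
    with l e1 e2 e3 e4 e5 e6 e7 e8 e9 α β φ
  refine (abs_rectAvg_mul_cos_le (fun q => noise a u q.1 q.2 x) _ _ α β φ).trans ?_
  have e8' : (0 : ℝ) < N l := by exact_mod_cast e8
  have e9' : (0 : ℝ) < M l := by exact_mod_cast e9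
  rw [one_div, inv_mul_le_iff₀ (by positivity)]
  refine (norm_sum_rect_le e1 e2 e3.2 e4.2 e3.1 e4.1 α β).trans ?_
  have f1 : ((J l : ℝ) + 1) ^ 4 ≤ N l := by exact_mod_cast e3.1
  have f2 : ((I l : ℝ) + 1) ^ 4 ≤ M l := by exact_mod_cast e4.1
  have g1 : (N l : ℝ) ≤ K * M l := by exact_mod_cast e1
  have g2 : (M l : ℝ) ≤ K * N l := by exact_mod_cast e2
  have k1 : ((J l : ℝ) + 1) ^ 4 * ((I l : ℝ) + 1) ^ 4 ≤ N l * M l := by gcongr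
  have k2 : ((J l : ℝ) + 1) ^ 8 ≤ K * (N l * M l) := by
    calc ((J l : ℝ) + 1) ^ 8 = ((J l : ℝ) + 1) ^ 4 * ((J l : ℝ) + 1) ^ 4 := by ring
      _ ≤ (N l : ℝ) * (K * M l) := by
        gcongr
        exact f1.trans g1
      _ = _ := by ring
  have k3 : ((I l : ℝ) + 1) ^ 8 ≤ K * (N l * M l) := by
    calc ((I l : ℝ) + 1) ^ 8 = ((I l : ℝ) + 1) ^ 4 * ((I l : ℝ) + 1) ^ 4 := by ring
      _ ≤ ((K : ℝ) * N l) * M l := by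
        gcongr
        exact f2.trans g2
      _ = _ := by ring
  calc _ ≤ δ * (((J l : ℝ) + 1) ^ 4 * ((I l : ℝ) + 1) ^ 4) +
        (δ * ((J l : ℝ) + 1) ^ 8 + δ * ((I l : ℝ) + 1) ^ 8) := by
        exact add_le_add (e5 α β) (add_le_add e6 e7)
    _ ≤ δ * (N l * M l) + (δ * (K * (N l * M l)) + δ * (K * (N l * M l))) := by gcongr
    _ = N l * M l * ε := by rw [hδ]; field_simp; ring

end AlmostSure

end SinusoidLSE

/-! ### Strong consistency of the least squares estimates -/

theorem theorem1 {Ω : Type*} [MeasurableSpace Ω] (μ : Measure Ω) [IsProbabilityMeasure μ]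
    (k P : ℕ) (hkP : k < P)
    -- the true parameters, the noise and the observed field
    (θ₀ : Params P) (a : ℤ × ℤ → ℝ) (u : ℤ × ℤ → Ω → ℝ)
    (hu : DrivingField μ u) (ha : AbsSummable a)
    (hfreq : DistinctFrequencies θ₀) (hamp : DominantFirst k θ₀)
    -- the parameter space, which contains the parameters of the `k` dominant sinusoids
    (Θ : Set (Params k)) (hΘ : IsParameterSpace Θ) (hθ₀ : firstParams hkP.le θ₀ ∈ Θ)
    -- the growing rectangles and the least squares estimates computed from them
    (N M : ℕ → ℕ) (hNM : RectanglesTendToInfinity N M)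
    (est : ℕ → Ω → Params k)
    (hest : ∀ i, ∀ᵐ x ∂μ,
      IsLeastSquaresEstimate Θ (fun n m => observed θ₀ a u n m x) (N i) (M i) (est i x)) :
    -- convergence to the parameters of the `k` dominant sinusoids, if no other vector of the
    -- parameter space describes the same sinusoids
    ((∀ θ ∈ Θ, SameSinusoids θ (firstParams hkP.le θ₀) → θ = firstParams hkP.le θ₀) →
      ∀ᵐ x ∂μ, Tendsto (fun i => est i x) atTop (𝓝 (firstParams hkP.le θ₀))) ∧
    -- and, in general, to the set of the vectors that describe the same sinusoids
    (∀ᵐ x ∂μ, Tendsto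
      (fun i => Metric.infDist (est i x) {θ ∈ Θ | SameSinusoids θ (firstParams hkP.le θ₀)})
      atTop (𝓝 0)) := by
  have hN : Tendsto N atTop atTop :=
    tendsto_atTop_mono (fun l => min_le_left _ _) hNM.min_tendsto
  have hM : Tendsto M atTop atTop :=
    tendsto_atTop_mono (fun l => min_le_right _ _) hNM.min_tendsto
  have main : ∀ᵐ x ∂μ, Tendsto
      (fun i => Metric.infDist (est i x) {θ ∈ Θ | SameSinusoids θ (firstParams hkP.le θ₀)})
      atTop (𝓝 0) := by
    filter_upwards [hu.ae_uniformlyOrthogonal ha hNM, ae_all_iff.2 hest] with x hx hex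
    exact tendsto_infDist hkP hfreq hamp hΘ hθ₀ hN hM hx hex
  refine ⟨fun huniq => ?_, main⟩
  have hset : {θ ∈ Θ | SameSinusoids θ (firstParams hkP.le θ₀)} = {firstParams hkP.le θ₀} :=
    Set.eq_singleton_iff_unique_mem.2
      ⟨⟨hθ₀, Equiv.refl _, fun _ _ _ => rfl⟩, fun θ hθ => huniq θ hθ.1 hθ.2⟩
  filter_upwards [main] with x hx
  rw [tendsto_iff_dist_tendsto_zero]
  simpa only [hset, Metric.infDist_singleton] using hx
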